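/- Let $(X,\mathfrak M,\mu)$ be a $\sigma$-finite measure space. A positive kernel operator on the complex space $L^2(X,\mu)$ is a bounded operator $A$ for which there is a $\mu\times\mu$-measurable, almost everywhere nonnegative function $a$ on $X\times X$ (its kernel) such that, for every $f\in L^2(X,\mu)$ and almost every $x$, $\int_X|a(x,y)f(y)|\,d\mu(y)<\infty$ and $(Af)(x)=\int_X a(x,y)f(y)\,d\mu(y)$. Operators on $L^2(X,\mu)$ with kernels $a_1,\dots,a_m$ have as Hadamard product $A_1^{(\alpha)}\circ\cdots\circ A_m^{(\alpha)}$ the operator with kernel $a_1(x,y)^{\alpha}\cdots a_m(x,y)^{\alpha}$. For sets of operators put $\Psi^*=\{A^*:A\in\Psi\}$, $\Psi\Phi=\{AB:A\in\Psi,B\in\Phi\}$, $\Psi^n=\{A_1\cdots A_n:A_i\in\Psi\}$, $\Psi_1^{(\alpha)}\circ\cdots\circ\Psi_m^{(\alpha)}=\{A_1^{(\alpha)}\circ\cdots\circ A_m^{(\alpha)}:A_j\in\Psi_j\}$, $\|\Psi\|=\sup_{A\in\Psi}\|A\|$, and let $$\rho(\Psi)=\limsup_{n\to\infty}\Big[\sup_{A\in\Psi^n}\rho(A)\Big]^{1/n},\qquad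 \hat\rho(\Psi)=\lim_{n\to\infty}\Big[\sup_{A\in\Psi^n}\|A\|\Big]^{1/n}$$ be the generalized and the joint spectral radius, where $\rho(A)$ is the spectral radius of $A$ (and $\sup\emptyset=0$). Let $m\ge 1$, let $\tau,\nu$ be permutations of $\{1,\dots,m\}$, and let $r\in\{\rho,\hat\rho\}$. For sets $\Psi_1,\dots,\Psi_m$ of operators put, for $j=1,\dots,m$, $$\Omega_j=\Psi_{\tau(j)}^*\Psi_{\nu(j)}\cdots\Psi_{\tau(m)}^*\Psi_{\nu(m)}\Psi_{\tau(1)}^*\Psi_{\nu(1)}\cdots\Psi_{\tau(j-1)}^*\Psi_{\nu(j-1)} .$$ (i) If $\Psi_1,\dots,\Psi_m$ are bounded sets of positive kernel operators on $L^2(X,\mu)$, then $$\|\Psi_1^{(1/m)}\circ\cdots\circ\Psi_m^{(1/m)}\|\le r\big((\Psi_{\tau(1)}^*\Psi_{\nu(1)})^{(1/m)}\circ\cdots\circ(\Psi_{\tau(m)}^*\Psi_{\nu(m)})^{(1/m)}\big)^{1/2}$$ $$\le r\big(\Omega_1^{(1/m)}\circ\cdots\circ\Omega_m^{(1/m)}\big)^{1/(2m)}\le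 r\big(\Psi_{\tau(1)}^*\Psi_{\nu(1)}\cdots\Psi_{\tau(m)}^*\Psi_{\nu(m)}\big)^{1/(2m)} .$$ (ii) Let $R$ be a countable (finite or infinite) index set. If $\Psi_1,\dots,\Psi_m$ are bounded sets of nonnegative matrices that define operators on $\ell^2(R)$ (that is, on $L^2(R)$ with the counting measure), and if $\alpha\ge 1/m$, then $$\|\Psi_1^{(\alpha)}\circ\cdots\circ\Psi_m^{(\alpha)}\|\le r\big((\Psi_{\tau(1)}^*\Psi_{\nu(1)})^{(\alpha)}\circ\cdots\circ(\Psi_{\tau(m)}^*\Psi_{\nu(m)})^{(\alpha)}\big)^{1/2}$$ $$\le r\big(\Omega_1^{(\alpha)}\circ\cdots\circ\Omega_m^{(\alpha)}\big)^{1/(2m)}\le r\big(\Psi_{\tau(1)}^*\Psi_{\nu(1)}\cdots\Psi_{\tau(m)}^*\Psi_{\nu(m)}\big)^{\alpha/2} .$$ In both parts, all the Hadamard products that occur are defined as bounded operators on the whole space. -/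

import Mathlib

open MeasureTheory Filter
open scoped Pointwise ENNReal

/-- Bounded linear operators on the complex Hilbert space `L²(X, μ)`. For sets of such operators the
pointwise operations are `Ψ * Φ = {A B : A ∈ Ψ, B ∈ Φ}`, `Ψ ^ n = {A₁ ⋯ Aₙ : Aᵢ ∈ Ψ}` and
`star Ψ = {A* : A ∈ Ψ}`, where `A*` is the Hilbert space adjoint. -/
abbrev L2Op {X : Type*} [MeasurableSpace X] (μ : Measure X) : Type _ :=
  Lp ℂ 2 μ →L[ℂ] Lp ℂ 2 μ

/-- `A` is a positive kernel operator on `L²(X, μ)` with kernel `a`: the function `a` is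
`μ × μ`-measurable, nonnegative almost everywhere, and for every `f ∈ L²(X, μ)` and almost every `x`
the function `y ↦ a(x, y) f(y)` is integrable and `(A f)(x) = ∫ a(x, y) f(y) dμ(y)`. -/
structure HasNonnegKernel {X : Type*} [MeasurableSpace X] (μ : Measure X)
    (A : L2Op μ) (a : X → X → ℝ) : Prop where
  aemeasurable : AEMeasurable (fun p : X × X => a p.1 p.2) (μ.prod μ)
  nonneg : ∀ᵐ p : X × X ∂(μ.prod μ), 0 ≤ a p.1 p.2
  apply : ∀ f : Lp ℂ 2 μ, ∀ᵐ x ∂μ,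
    Integrable (fun y => (a x y : ℂ) * f y) μ ∧ A f x = ∫ y, (a x y : ℂ) * f y ∂μ

/-- `A` is a positive kernel operator on `L²(X, μ)`. -/
def IsPositiveKernelOperator {X : Type*} [MeasurableSpace X] (μ : Measure X) (A : L2Op μ) : Prop :=
  ∃ a : X → X → ℝ, HasNonnegKernel μ A a

/-- `C` is the Hadamard product `A₁^(α) ∘ ⋯ ∘ Aₘ^(α)`: the operator on the whole of `L²(X, μ)` whose
kernel is `a₁(x, y)^α ⋯ aₘ(x, y)^α`, where `aⱼ` is the kernel of `Aⱼ`. (For σ-finite `μ` the kernel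
of an operator is unique almost everywhere.) -/
def IsHadamardProduct {X : Type*} [MeasurableSpace X] (μ : Measure X) {m : ℕ} (α : ℝ)
    (A : Fin m → L2Op μ) (C : L2Op μ) : Prop :=
  ∃ a : Fin m → X → X → ℝ, (∀ j, HasNonnegKernel μ (A j) (a j)) ∧
    HasNonnegKernel μ C (fun x y => ∏ j, a j x y ^ α)

/-- The set `Φ₁^(α) ∘ ⋯ ∘ Φₘ^(α) = {A₁^(α) ∘ ⋯ ∘ Aₘ^(α) : A₁ ∈ Φ₁, …, Aₘ ∈ Φₘ}`. -/
def hadamardSet {X : Type*} [MeasurableSpace X] (μ : Measure X) {m : ℕ} (α : ℝ)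
    (Φ : Fin m → Set (L2Op μ)) : Set (L2Op μ) :=
  {C | ∃ A : Fin m → L2Op μ, (∀ j, A j ∈ Φ j) ∧ IsHadamardProduct μ α A C}

/-- Every Hadamard product `A₁^(α) ∘ ⋯ ∘ Aₘ^(α)` with `Aⱼ ∈ Φⱼ` is defined as a bounded operator on
the whole of `L²(X, μ)`, so that no choice of the `Aⱼ` is lost in `hadamardSet μ α Φ`. -/
def HadamardDefined {X : Type*} [MeasurableSpace X] (μ : Measure X) {m : ℕ} (α : ℝ)
    (Φ : Fin m → Set (L2Op μ)) : Prop :=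
  ∀ A : Fin m → L2Op μ, (∀ j, A j ∈ Φ j) → ∃ C : L2Op μ, IsHadamardProduct μ α A C

/-- The norm `‖Ψ‖ = sup {‖A‖ : A ∈ Ψ}` of a set of operators. -/
noncomputable def setNorm {E : Type*} [NormedAddCommGroup E] [NormedSpace ℂ E]
    (Ψ : Set (E →L[ℂ] E)) : ℝ≥0∞ :=
  ⨆ A ∈ Ψ, ‖A‖ₑ

/-- The generalized spectral radius `ρ(Ψ) = limsup (sup {ρ(A) : A ∈ Ψⁿ})^(1/n)`. -/
noncomputable def generalizedSpectralRadius {E : Type*} [NormedAddCommGroup E] [NormedSpace ℂ E]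
    (Ψ : Set (E →L[ℂ] E)) : ℝ≥0∞ :=
  limsup (fun n : ℕ => (⨆ A ∈ Ψ ^ n, spectralRadius ℂ A) ^ ((1 : ℝ) / n)) atTop

/-- The joint spectral radius `ρ̂(Ψ) = lim (sup {‖A‖ : A ∈ Ψⁿ})^(1/n)`. For bounded `Ψ` the limit
exists, since the sequence of suprema is submultiplicative; it is then the upper limit. -/
noncomputable def jointSpectralRadius {E : Type*} [NormedAddCommGroup E] [NormedSpace ℂ E]
    (Ψ : Set (E →L[ℂ] E)) : ℝ≥0∞ :=
  limsup (fun n : ℕ => setNorm (Ψ ^ n) ^ ((1 : ℝ) / n)) atTop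

/-- The product `Θ_j Θ_{j+1} ⋯ Θ_m Θ_1 ⋯ Θ_{j-1}` (the addition in `Fin m` is cyclic). -/
def cyclicProduct {M : Type*} [Monoid M] {m : ℕ} (Θ : Fin m → M) (j : Fin m) : M :=
  (List.ofFn fun k : Fin m => Θ (j + k)).prod

/-- The family of sets `Ψ_{τ(j)}* Ψ_{ν(j)}`, for `j = 1, …, m`. -/
def adjointProduct {X : Type*} [MeasurableSpace X] {μ : Measure X} {m : ℕ}
    (Ψ : Fin m → Set (L2Op μ)) (τ ν : Equiv.Perm (Fin m)) (j : Fin m) : Set (L2Op μ) :=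
  star (Ψ (τ j)) * Ψ (ν j)

/-- The family of the cyclic shifts
`Ω_j = Ψ_{τ(j)}* Ψ_{ν(j)} ⋯ Ψ_{τ(m)}* Ψ_{ν(m)} Ψ_{τ(1)}* Ψ_{ν(1)} ⋯ Ψ_{τ(j-1)}* Ψ_{ν(j-1)}`. -/
def shiftedProduct {X : Type*} [MeasurableSpace X] {μ : Measure X} {m : ℕ}
    (Ψ : Fin m → Set (L2Op μ)) (τ ν : Equiv.Perm (Fin m)) (j : Fin m) : Set (L2Op μ) :=
  cyclicProduct (adjointProduct Ψ τ ν) j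

/-- `ℓ²(R)`, for a countable index set `R`, is `L²(R, μ)` for the counting measure `μ`. The operator
`A` on it is defined by the matrix `a` with nonnegative entries: `(A f)_i = ∑_j a_ij f_j`. -/
def HasNonnegMatrix {R : Type*} [MeasurableSpace R] (A : L2Op (Measure.count : Measure R))
    (a : Matrix R R ℝ) : Prop :=
  (∀ i j, 0 ≤ a i j) ∧ ∀ (f : Lp ℂ 2 (Measure.count : Measure R)) (i : R),
    Summable (fun j => (a i j : ℂ) * f j) ∧ A f i = ∑' j, (a i j : ℂ) * f j

/-- `A` is the operator on `ℓ²(R)` defined by some nonnegative matrix. -/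
def IsNonnegMatrixOperator {R : Type*} [MeasurableSpace R]
    (A : L2Op (Measure.count : Measure R)) : Prop :=
  ∃ a : Matrix R R ℝ, HasNonnegMatrix A a

/-- On `ℓ²(R)` nonnegative matrices and kernels of positive kernel operators are the same, so that
`IsHadamardProduct` is the entrywise product of entrywise powers of matrices. -/
theorem hasNonnegKernel_count_iff {R : Type*} [Countable R] [MeasurableSpace R]
    [DiscreteMeasurableSpace R] (A : L2Op (Measure.count : Measure R)) (a : Matrix R R ℝ) :
    HasNonnegKernel (Measure.count : Measure R) A a ↔ HasNonnegMatrix A a := by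
  have hp : ((Measure.count : Measure R).prod (Measure.count : Measure R)) = Measure.count := by
    refine Measure.ext_of_singleton fun p => ?_
    rw [← Prod.mk.eta (p := p), ← Set.singleton_prod_singleton, Measure.prod_prod,
      Set.singleton_prod_singleton]
    simp
  have hint : ∀ g : R → ℂ, Integrable g (Measure.count : Measure R) ↔ Summable g := fun g => by
    rw [integrable_count_iff, summable_norm_iff]
  have hsum : ∀ g : R → ℂ, Summable g → ∫ y, g y ∂(Measure.count : Measure R) = ∑' y, g y :=
    fun g hg => by
      rw [integral_countable ((hint g).2 hg)]
      simp [Measure.real]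
  constructor
  · rintro ⟨-, h2, h3⟩
    rw [hp, Measure.ae_count_iff] at h2
    refine ⟨fun i j => h2 (i, j), fun f i => ?_⟩
    obtain ⟨h4, h5⟩ := Measure.ae_count_iff.1 (h3 f) i
    have h6 := (hint _).1 h4
    exact ⟨h6, by rw [h5, hsum _ h6]⟩
  · rintro ⟨h2, h3⟩
    refine ⟨(Measurable.of_discrete).aemeasurable, .of_forall fun p => h2 _ _,
      fun f => .of_forall fun i => ?_⟩
    exact ⟨(hint _).2 (h3 f i).1, by rw [(h3 f i).2, hsum _ (h3 f i).1]⟩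

/-!
Write `H(Φ)` for the set of Hadamard products `A₁^(α) ∘ ⋯ ∘ Aₘ^(α)` with `Aⱼ ∈ Φⱼ`, and
`Θⱼ = Ψ_{τ(j)}* Ψ_{ν(j)}`. Everything rests on two properties of the exponent `α`, collected in
`HadamardExponent`: Hölder's inequality `∫ ∏ fⱼ^α ≤ ∏ (∫ fⱼ)^α` and the bound
`‖A₁^(α) ∘ ⋯ ∘ Aₘ^(α)‖ ≤ ∏ ‖Aⱼ‖^α`. For `α = 1 / m` both are the generalized Hölder inequality. For
the counting measure and `α ≥ 1 / m` they follow from this case, since `∑ tᵢ^β ≤ (∑ tᵢ)^β` for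
`β ≥ 1` and since the entries of a matrix are at most its norm.

Applied to the kernels, Hölder's inequality says that a product of Hadamard products is dominated by
the Hadamard product of the products (`HadamardExponent.exists_mul`). If `B` dominates `A`, then
`‖A‖ ≤ ‖B‖`, and by Gelfand's formula the same holds for the spectral radii. This gives the three
inequalities.

* If `C` is a Hadamard product of `Aⱼ ∈ Ψⱼ`, then `C* C` is dominated by an element of `H(Θ)`, because
  the factors of `C*` and of `C` may be permuted by `τ` and by `ν`; and `‖C‖² = ρ(C* C)`.
* In a product `D₁ ⋯ Dₘ` of elements of `H(Θ)` the factors of `Dₖ` may be shifted cyclically by `k`, so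
  that the product is dominated by an element of `H(Ω)`. Hence `r(H(Θ))^m ≤ r(H(Ω))`.
* The bound on the norms of Hadamard products, applied to powers, gives `r(H(Ω)) ≤ s^(m α)` as soon as
  `r(Ωⱼ) ≤ s` for all `j`. The sets `Ωⱼ` are cyclic shifts of `Ω₁`, so they all have the same radius.

Kernels are handled as measurable functions with values in `[0, ∞]` (`HasKernel`), and domination is
defined on operators and not on kernels (`Dominated`), so that the almost everywhere uniqueness of
kernels is never needed.
-/

/-! ### Operators with a nonnegative kernel -/

section Kernels

variable {X : Type*} [MeasurableSpace X] {μ : Measure X}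

theorem lintegral_enorm_sq (F : Lp ℂ 2 μ) : ∫⁻ y, ‖F y‖ₑ ^ 2 ∂μ = ‖F‖ₑ ^ 2 := by
  rw [Lp.enorm_def, eLpNorm_eq_lintegral_rpow_enorm_toReal (by norm_num) (by norm_num),
    ← ENNReal.rpow_natCast, ← ENNReal.rpow_mul]
  simp

theorem exists_Lp_eq_toReal {f : X → ℝ≥0∞} (hf : AEMeasurable f μ) (h : ∫⁻ y, f y ^ 2 ∂μ ≠ ∞) :
    ∃ F : Lp ℂ 2 μ, (∀ᵐ y ∂μ, F y = ((f y).toReal : ℂ)) ∧ ∀ᵐ y ∂μ, ‖F y‖ₑ = f y := by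
  have hfin : ∀ᵐ y ∂μ, f y ≠ ∞ := by
    filter_upwards [ae_lt_top' (hf.pow_const 2) h] with y hy hy'
    simp [hy'] at hy
  have hnorm : ∀ᵐ y ∂μ, ‖((f y).toReal : ℂ)‖ₑ = f y := by
    filter_upwards [hfin] with y hy
    rw [← ofReal_norm, Complex.norm_real, Real.norm_of_nonneg ENNReal.toReal_nonneg,
      ENNReal.ofReal_toReal hy]
  have hmem : MemLp (fun y => ((f y).toReal : ℂ)) 2 μ := by
    refine ⟨(Complex.measurable_ofReal.comp_aemeasurable hf.ennreal_toReal).aestronglyMeasurable, ?_⟩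
    rw [eLpNorm_eq_lintegral_rpow_enorm_toReal (by norm_num) (by norm_num)]
    refine ENNReal.rpow_lt_top_of_nonneg (by simp) ?_
    rw [lintegral_congr_ae (g := fun y => f y ^ 2)]
    · exact h
    · filter_upwards [hnorm] with y hy
      simp [hy]
  refine ⟨hmem.toLp, hmem.coeFn_toLp, ?_⟩
  filter_upwards [hmem.coeFn_toLp, hnorm] with y hy hy'
  rw [hy, hy']

theorem exists_Lp_eq_norm (f : Lp ℂ 2 μ) : ∃ g : Lp ℂ 2 μ, (∀ᵐ y ∂μ, g y = (‖f y‖ : ℂ)) ∧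
    (∀ᵐ y ∂μ, g y = (‖g y‖ : ℂ)) ∧ ∀ᵐ y ∂μ, ‖g y‖ₑ = ‖f y‖ₑ := by
  obtain ⟨g, hg, hg'⟩ := exists_Lp_eq_toReal (μ := μ) (f := fun y => ‖f y‖ₑ)
    (Lp.aestronglyMeasurable f).enorm (by rw [lintegral_enorm_sq]; finiteness)
  simp only [toReal_enorm] at hg
  refine ⟨g, hg, ?_, hg'⟩
  filter_upwards [hg] with y hy
  simp [hy]

/-- On a σ-finite space there is a square integrable function with values in `(0, ∞)`. -/
theorem exists_pos_lintegral_sq_ne_top (μ : Measure X) [SigmaFinite μ] :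
    ∃ w : X → ℝ≥0∞, Measurable w ∧ (∀ x, w x ≠ 0) ∧ (∀ x, w x ≠ ∞) ∧ ∫⁻ x, w x ^ 2 ∂μ ≠ ∞ := by
  obtain ⟨g, hg, hgm, hgi⟩ := exists_pos_lintegral_lt_of_sigmaFinite μ (ε := 1) one_ne_zero
  refine ⟨fun x => (g x : ℝ≥0∞) ^ (1 / 2 : ℝ), by fun_prop, fun x => ?_, fun x => ?_, ?_⟩
  · simp [(hg x).ne']
  · exact ENNReal.rpow_ne_top_of_nonneg (by norm_num) (by simp)
  · have : ∀ x, ((g x : ℝ≥0∞) ^ (1 / 2 : ℝ)) ^ 2 = g x := fun x => by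
      rw [← ENNReal.rpow_natCast, ← ENNReal.rpow_mul]; norm_num
    simp_rw [this]
    exact (hgi.trans ENNReal.one_lt_top).ne

/-- The measurable function `k`, with values in `[0, ∞]`, is a kernel of the operator `A`. In contrast
to `HasNonnegKernel`, the kernel is measurable and not just almost everywhere measurable, and integrals
of nonnegative functions against it make sense without an integrability condition. -/
structure HasKernel (A : L2Op μ) (k : X → X → ℝ≥0∞) : Prop where
  measurable : Measurable (Function.uncurry k)
  lintegral_ne_top : ∀ f : Lp ℂ 2 μ, ∀ᵐ x ∂μ, ∫⁻ y, k x y * ‖f y‖ₑ ∂μ ≠ ∞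
  apply_eq : ∀ f : Lp ℂ 2 μ, ∀ᵐ x ∂μ, A f x = ∫ y, ((k x y).toReal : ℂ) * f y ∂μ

theorem enorm_toReal_mul_le (a : ℝ≥0∞) (z : ℂ) : ‖(a.toReal : ℂ) * z‖ₑ ≤ a * ‖z‖ₑ := by
  rw [enorm_mul]
  gcongr
  rw [← ofReal_norm, Complex.norm_real, Real.norm_of_nonneg ENNReal.toReal_nonneg]
  exact ENNReal.ofReal_toReal_le

theorem integrable_toReal_mul {κ : X → ℝ≥0∞} (hκ : Measurable κ) {f : X → ℂ}
    (hf : AEStronglyMeasurable f μ) (h : ∫⁻ y, κ y * ‖f y‖ₑ ∂μ ≠ ∞) :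
    Integrable (fun y => ((κ y).toReal : ℂ) * f y) μ := by
  refine ⟨(Complex.measurable_ofReal.comp hκ.ennreal_toReal).aestronglyMeasurable.mul hf, ?_⟩
  exact (lintegral_mono fun y => enorm_toReal_mul_le _ _).trans_lt h.lt_top

namespace HasKernel

variable {A B : L2Op μ} {k l : X → X → ℝ≥0∞}

theorem measurable_section (hA : HasKernel A k) (x : X) : Measurable (k x) :=
  hA.measurable.comp measurable_prodMk_left

theorem integrable (hA : HasKernel A k) (f : Lp ℂ 2 μ) :
    ∀ᵐ x ∂μ, Integrable (fun y => ((k x y).toReal : ℂ) * f y) μ := by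
  filter_upwards [hA.lintegral_ne_top f] with x hx
  exact integrable_toReal_mul (hA.measurable_section x) (Lp.aestronglyMeasurable f) hx

/-- A kernel is finite almost everywhere, by testing it on a strictly positive function in `L²`. -/
theorem ae_ne_top [SigmaFinite μ] (hA : HasKernel A k) : ∀ᵐ x ∂μ, ∀ᵐ y ∂μ, k x y ≠ ∞ := by
  obtain ⟨w, hwm, hw0, -, hwi⟩ := exists_pos_lintegral_sq_ne_top μ
  obtain ⟨F, -, hF⟩ := exists_Lp_eq_toReal hwm.aemeasurable hwi
  filter_upwards [hA.lintegral_ne_top F] with x hx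
  have hm : AEMeasurable (fun y => k x y * ‖F y‖ₑ) μ :=
    (hA.measurable_section x).aemeasurable.mul (Lp.aestronglyMeasurable F).enorm
  filter_upwards [ae_lt_top' hm hx, hF] with y hy hFy hk
  rw [hFy, hk, ENNReal.top_mul (hw0 y)] at hy
  exact lt_irrefl _ hy

theorem enorm_apply_le (hA : HasKernel A k) (f : Lp ℂ 2 μ) :
    ∀ᵐ x ∂μ, ‖A f x‖ₑ ≤ ∫⁻ y, k x y * ‖f y‖ₑ ∂μ := by
  filter_upwards [hA.apply_eq f] with x hx
  rw [hx]
  exact (enorm_integral_le_lintegral_enorm _).trans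
    (lintegral_mono fun y => enorm_toReal_mul_le _ _)

theorem apply_of_nonneg [SigmaFinite μ] (hA : HasKernel A k) {f : Lp ℂ 2 μ}
    (hf : ∀ᵐ y ∂μ, f y = (‖f y‖ : ℂ)) :
    ∀ᵐ x ∂μ, A f x = ((∫⁻ y, k x y * ‖f y‖ₑ ∂μ).toReal : ℂ) ∧
      ‖A f x‖ₑ = ∫⁻ y, k x y * ‖f y‖ₑ ∂μ := by
  filter_upwards [hA.apply_eq f, hA.lintegral_ne_top f, hA.ae_ne_top] with x hx hx' hfin
  have key : A f x = ((∫⁻ y, k x y * ‖f y‖ₑ ∂μ).toReal : ℂ) := by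
    rw [hx, ← integral_toReal, ← integral_complex_ofReal]
    · refine integral_congr_ae ?_
      filter_upwards [hf] with y hy
      rw [hy]
      simp
    · exact (hA.measurable_section x).aemeasurable.mul (Lp.aestronglyMeasurable f).enorm
    · filter_upwards [hfin] with y hy
      exact ENNReal.mul_lt_top hy.lt_top enorm_lt_top
  refine ⟨key, ?_⟩
  rw [key, ← ofReal_norm, Complex.norm_real, Real.norm_of_nonneg ENNReal.toReal_nonneg,
    ENNReal.ofReal_toReal hx']

end HasKernel

/-! ### Composition and adjoint -/

/-- The kernel of the product of two operators with kernels `k` and `l`. -/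
noncomputable def kernelComp (μ : Measure X) (k l : X → X → ℝ≥0∞) (x y : X) : ℝ≥0∞ :=
  ∫⁻ z, k x z * l z y ∂μ

variable {k l : X → X → ℝ≥0∞}

theorem measurable_kernelComp [SigmaFinite μ] (hk : Measurable (Function.uncurry k))
    (hl : Measurable (Function.uncurry l)) : Measurable (Function.uncurry (kernelComp μ k l)) := by
  have h : Measurable fun q : (X × X) × X => k q.1.1 q.2 * l q.2 q.1.2 :=
    (hk.comp (f := fun q : (X × X) × X => (q.1.1, q.2)) (by fun_prop)).mul
      (hl.comp (f := fun q : (X × X) × X => (q.2, q.1.2)) (by fun_prop))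
  exact h.lintegral_prod_right'

theorem lintegral_kernelComp_mul [SigmaFinite μ] (hk : Measurable (Function.uncurry k))
    (hl : Measurable (Function.uncurry l)) {φ : X → ℝ≥0∞} (hφ : AEMeasurable φ μ) (x : X) :
    ∫⁻ y, kernelComp μ k l x y * φ y ∂μ = ∫⁻ z, k x z * ∫⁻ y, l z y * φ y ∂μ ∂μ := by
  have h1 : ∀ z, Measurable (l z) := fun z => hl.comp measurable_prodMk_left
  have h2 : ∀ y, Measurable fun z => l z y := fun y => hl.comp measurable_prodMk_right
  have h3 : Measurable (k x) := hk.comp measurable_prodMk_left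
  calc ∫⁻ y, kernelComp μ k l x y * φ y ∂μ
      = ∫⁻ y, ∫⁻ z, k x z * l z y * φ y ∂μ ∂μ := by
        refine lintegral_congr fun y => ?_
        exact (lintegral_mul_const _ (h3.mul (h2 y))).symm
    _ = ∫⁻ z, ∫⁻ y, k x z * l z y * φ y ∂μ ∂μ := by
        refine lintegral_lintegral_swap ?_
        refine AEMeasurable.mul (Measurable.aemeasurable ?_)
          (hφ.comp_quasiMeasurePreserving Measure.quasiMeasurePreserving_fst)
        exact (h3.comp measurable_snd).mul (hl.comp measurable_swap)
    _ = ∫⁻ z, k x z * ∫⁻ y, l z y * φ y ∂μ ∂μ := by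
        refine lintegral_congr fun z => ?_
        simp_rw [mul_assoc]
        exact lintegral_const_mul'' _ ((h1 z).aemeasurable.mul hφ)

theorem ae_ae_swap [SigmaFinite μ] {p : X → X → Prop} (hp : MeasurableSet {q : X × X | p q.1 q.2})
    (h : ∀ᵐ x ∂μ, ∀ᵐ y ∂μ, p x y) : ∀ᵐ y ∂μ, ∀ᵐ x ∂μ, p x y :=
  (Measure.ae_ae_comm hp).1 h

namespace HasKernel

variable [SigmaFinite μ] {A B : L2Op μ}

theorem mul (hA : HasKernel A k) (hB : HasKernel B l) : HasKernel (A * B) (kernelComp μ k l) := by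
  have hne : ∀ f : Lp ℂ 2 μ, ∀ᵐ x ∂μ,
      ∫⁻ z, k x z * ∫⁻ y, l z y * ‖f y‖ₑ ∂μ ∂μ ≠ ∞ := by
    intro f
    obtain ⟨g, -, hgn, hge⟩ := exists_Lp_eq_norm f
    filter_upwards [hA.lintegral_ne_top (B g)] with x hx
    rwa [lintegral_congr_ae (g := fun z => k x z * ‖B g z‖ₑ)]
    filter_upwards [hB.apply_of_nonneg hgn] with z hz
    rw [hz.2]
    congr 1
    refine lintegral_congr_ae ?_
    filter_upwards [hge] with y hy
    rw [hy]
  refine ⟨measurable_kernelComp hA.measurable hB.measurable, fun f => ?_, fun f => ?_⟩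
  · filter_upwards [hne f] with x hx
    rwa [lintegral_kernelComp_mul hA.measurable hB.measurable (Lp.aestronglyMeasurable f).enorm]
  · have hl' : ∀ᵐ y ∂μ, ∀ᵐ z ∂μ, l z y ≠ ∞ :=
      ae_ae_swap (hB.measurable (measurableSet_singleton ∞).compl) hB.ae_ne_top
    filter_upwards [hne f, hA.apply_eq (B f), hA.ae_ne_top] with x hx hAx hkx
    have hkm := hA.measurable_section x
    have hint : Integrable (Function.uncurry fun z y =>
        ((k x z).toReal : ℂ) * (((l z y).toReal : ℂ) * f y)) (μ.prod μ) := by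
      have hfm : AEStronglyMeasurable (fun q : X × X => f q.2) (μ.prod μ) :=
        (Lp.aestronglyMeasurable f).comp_quasiMeasurePreserving
          Measure.quasiMeasurePreserving_snd
      have hm1 : Measurable fun q : X × X => ((l q.1 q.2).toReal : ℂ) :=
        Complex.measurable_ofReal.comp hB.measurable.ennreal_toReal
      have hm2 : Measurable fun q : X × X => ((k x q.1).toReal : ℂ) :=
        Complex.measurable_ofReal.comp (hkm.comp measurable_fst).ennreal_toReal
      refine ⟨hm2.aestronglyMeasurable.mul (hm1.aestronglyMeasurable.mul hfm), ?_⟩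
      refine lt_of_le_of_lt (lintegral_mono (g := fun q : X × X =>
        k x q.1 * (l q.1 q.2 * ‖f q.2‖ₑ)) fun q => ?_) ?_
      · exact (enorm_toReal_mul_le _ _).trans (mul_le_mul_right (enorm_toReal_mul_le _ _) _)
      · rw [lintegral_prod]
        · refine lt_of_eq_of_lt (lintegral_congr fun z => ?_) hx.lt_top
          exact lintegral_const_mul'' (k x z) ((hB.measurable_section z).aemeasurable.mul
            (Lp.aestronglyMeasurable f).enorm)
        · exact (hkm.comp measurable_fst).aemeasurable.mul
            (hB.measurable.aemeasurable.mul hfm.enorm)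
    calc A (B f) x = ∫ z, ((k x z).toReal : ℂ) * B f z ∂μ := hAx
      _ = ∫ z, ∫ y, ((k x z).toReal : ℂ) * (((l z y).toReal : ℂ) * f y) ∂μ ∂μ := by
        refine integral_congr_ae ?_
        filter_upwards [hB.apply_eq f] with z hz
        rw [hz, integral_const_mul]
      _ = ∫ y, ∫ z, ((k x z).toReal : ℂ) * (((l z y).toReal : ℂ) * f y) ∂μ ∂μ :=
        integral_integral_swap hint
      _ = ∫ y, ((kernelComp μ k l x y).toReal : ℂ) * f y ∂μ := by
        refine integral_congr_ae ?_
        filter_upwards [hl'] with y hy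
        simp_rw [← mul_assoc]
        rw [integral_mul_const, kernelComp, ← integral_toReal, ← integral_complex_ofReal]
        · simp
        · exact (hkm.mul (hB.measurable.comp measurable_prodMk_right)).aemeasurable
        · filter_upwards [hy, hkx] with z hz hz'
          exact ENNReal.mul_lt_top hz'.lt_top hz.lt_top

theorem star (hA : HasKernel A k) : HasKernel (star A) fun x y => k y x := by
  have hks : Measurable (Function.uncurry fun x y => k y x) := hA.measurable.comp measurable_swap
  -- By Tonelli's theorem the integral is `∫ |f| A|g|`, which is finite since `|f|, A|g| ∈ L²`.
  have hne : ∀ f g : Lp ℂ 2 μ, ∫⁻ x, ‖g x‖ₑ * ∫⁻ y, k y x * ‖f y‖ₑ ∂μ ∂μ ≠ ∞ := by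
    intro f g
    obtain ⟨g', -, hg, hg'⟩ := exists_Lp_eq_norm g
    have h1 : ∫⁻ x, ‖g x‖ₑ * ∫⁻ y, k y x * ‖f y‖ₑ ∂μ ∂μ =
        ∫⁻ y, ‖f y‖ₑ * ∫⁻ x, k y x * ‖g x‖ₑ ∂μ ∂μ := by
      have hf := (Lp.aestronglyMeasurable f).enorm
      have hgm := (Lp.aestronglyMeasurable g).enorm
      have e1 : ∀ x, ‖g x‖ₑ * ∫⁻ y, k y x * ‖f y‖ₑ ∂μ = ∫⁻ y, ‖g x‖ₑ * (k y x * ‖f y‖ₑ) ∂μ :=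
        fun x => (lintegral_const_mul'' _
          ((hA.measurable.comp measurable_prodMk_right).aemeasurable.mul hf)).symm
      have e2 : ∀ y, ‖f y‖ₑ * ∫⁻ x, k y x * ‖g x‖ₑ ∂μ = ∫⁻ x, ‖f y‖ₑ * (k y x * ‖g x‖ₑ) ∂μ :=
        fun y => (lintegral_const_mul'' _ ((hA.measurable_section y).aemeasurable.mul hgm)).symm
      simp_rw [e1, e2]
      rw [lintegral_lintegral_swap]
      · simp_rw [mul_left_comm, mul_comm (‖g _‖ₑ)]
      · exact (hgm.comp_quasiMeasurePreserving Measure.quasiMeasurePreserving_fst).mul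
          (hks.aemeasurable.mul
            (hf.comp_quasiMeasurePreserving Measure.quasiMeasurePreserving_snd))
    have h2 : ∫⁻ y, ‖f y‖ₑ * ∫⁻ x, k y x * ‖g x‖ₑ ∂μ ∂μ = ∫⁻ y, ‖f y * A g' y‖ₑ ∂μ := by
      refine lintegral_congr_ae ?_
      filter_upwards [hA.apply_of_nonneg hg] with y hy
      rw [enorm_mul, hy.2]
      congr 1
      refine lintegral_congr_ae ?_
      filter_upwards [hg'] with x hx
      rw [hx]
    rw [h1, h2]
    exact (MemLp.integrable_mul (p := 2) (q := 2) (Lp.memLp f) (Lp.memLp (A g'))).2.ne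
  have hne' : ∀ f : Lp ℂ 2 μ, ∀ᵐ x ∂μ, ∫⁻ y, k y x * ‖f y‖ₑ ∂μ ≠ ∞ := by
    intro f
    obtain ⟨w, hwm, hw0, -, hwi⟩ := exists_pos_lintegral_sq_ne_top μ
    obtain ⟨g, -, hg⟩ := exists_Lp_eq_toReal hwm.aemeasurable hwi
    have hm : AEMeasurable (fun x => ‖g x‖ₑ * ∫⁻ y, k y x * ‖f y‖ₑ ∂μ) μ := by
      refine (Lp.aestronglyMeasurable g).enorm.mul (AEMeasurable.lintegral_prod_right'
        (f := fun q : X × X => k q.2 q.1 * ‖f q.2‖ₑ) ?_)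
      exact hks.aemeasurable.mul ((Lp.aestronglyMeasurable f).enorm.comp_quasiMeasurePreserving
        Measure.quasiMeasurePreserving_snd)
    filter_upwards [ae_lt_top' hm (hne f g), hg] with x hx hgx htop
    rw [htop, hgx, ENNReal.mul_top (hw0 x)] at hx
    exact lt_irrefl _ hx
  refine ⟨hks, hne', fun f => ?_⟩
  -- Both sides have the same integral against every nonnegative `g ∈ L²`.
  have key : ∀ g : Lp ℂ 2 μ, (∀ᵐ x ∂μ, g x = (‖g x‖ : ℂ)) →
      Integrable (fun x => g x * ∫ y, ((k y x).toReal : ℂ) * f y ∂μ) μ ∧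
      ∫ x, g x * ∫ y, ((k y x).toReal : ℂ) * f y ∂μ ∂μ = inner ℂ (A g) f := by
    intro g hg
    have hfm : AEStronglyMeasurable (fun q : X × X => f q.2) (μ.prod μ) :=
      (Lp.aestronglyMeasurable f).comp_quasiMeasurePreserving Measure.quasiMeasurePreserving_snd
    have hgm : AEStronglyMeasurable (fun q : X × X => g q.1) (μ.prod μ) :=
      (Lp.aestronglyMeasurable g).comp_quasiMeasurePreserving Measure.quasiMeasurePreserving_fst
    have hkm : Measurable fun q : X × X => ((k q.2 q.1).toReal : ℂ) :=
      Complex.measurable_ofReal.comp hks.ennreal_toReal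
    have hint : Integrable (Function.uncurry fun x y => g x * (((k y x).toReal : ℂ) * f y))
        (μ.prod μ) := by
      refine ⟨hgm.mul (hkm.aestronglyMeasurable.mul hfm), ?_⟩
      refine lt_of_le_of_lt (lintegral_mono (g := fun q : X × X =>
        ‖g q.1‖ₑ * (k q.2 q.1 * ‖f q.2‖ₑ)) fun q => ?_) ?_
      · simp only [Function.uncurry]
        rw [enorm_mul]
        exact mul_le_mul_right (enorm_toReal_mul_le _ _) _
      · rw [lintegral_prod]
        · refine lt_of_eq_of_lt (lintegral_congr fun x => ?_) (hne f g).lt_top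
          exact lintegral_const_mul'' (‖g x‖ₑ) ((hks.comp measurable_prodMk_left).aemeasurable.mul
            (Lp.aestronglyMeasurable f).enorm)
        · exact hgm.enorm.mul (hks.aemeasurable.mul hfm.enorm)
    have e : ∀ x, g x * ∫ y, ((k y x).toReal : ℂ) * f y ∂μ =
        ∫ y, g x * (((k y x).toReal : ℂ) * f y) ∂μ := fun x => (integral_const_mul _ _).symm
    simp_rw [e]
    refine ⟨hint.integral_prod_left, ?_⟩
    rw [integral_integral_swap hint, L2.inner_def]
    refine integral_congr_ae ?_
    filter_upwards [hA.apply_eq g, hA.apply_of_nonneg hg] with y hy hy'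
    have : (starRingEnd ℂ) (A g y) = A g y := by rw [hy'.1, Complex.conj_ofReal]
    rw [RCLike.inner_apply, this, hy, ← integral_const_mul]
    refine integral_congr_ae (.of_forall fun x => ?_)
    ring
  have hcoe : ∀ s (hs : MeasurableSet s) (hμ : μ s ≠ ∞) (h : X → ℂ),
      (fun x => (indicatorConstLp 2 hs hμ (1 : ℂ) : Lp ℂ 2 μ) x * h x) =ᵐ[μ] s.indicator h := by
    intro s hs hμ h
    filter_upwards [indicatorConstLp_coeFn (p := 2) (hs := hs) (hμs := hμ) (c := (1 : ℂ))] with x hx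
    rw [hx]
    by_cases hxs : x ∈ s <;> simp [hxs]
  have hpos : ∀ s (hs : MeasurableSet s) (hμ : μ s ≠ ∞),
      ∀ᵐ x ∂μ, (indicatorConstLp 2 hs hμ (1 : ℂ) : Lp ℂ 2 μ) x =
        (‖(indicatorConstLp 2 hs hμ (1 : ℂ) : Lp ℂ 2 μ) x‖ : ℂ) := by
    intro s hs hμ
    filter_upwards [indicatorConstLp_coeFn (p := 2) (hs := hs) (hμs := hμ) (c := (1 : ℂ))] with x hx
    rw [hx]
    by_cases hxs : x ∈ s <;> simp [hxs]
  refine ae_eq_of_forall_setIntegral_eq_of_sigmaFinite (fun s hs hμ => ?_) (fun s hs hμ => ?_)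
    fun s hs hμ => ?_
  · exact integrableOn_Lp_of_measure_ne_top _ (by norm_num) hμ.ne
  · rw [← integrable_indicator_iff hs]
    exact (key _ (hpos s hs hμ.ne)).1.congr (hcoe s hs hμ.ne _)
  · rw [← L2.inner_indicatorConstLp_one (𝕜 := ℂ) hs hμ.ne, ContinuousLinearMap.star_eq_adjoint,
      ContinuousLinearMap.adjoint_inner_right, ← (key _ (hpos s hs hμ.ne)).2,
      integral_congr_ae (hcoe s hs hμ.ne _), integral_indicator hs]

end HasKernel
end Kernels

/-! ### Bounded kernels and bounded operators -/

section Bounds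

variable {X : Type*} [MeasurableSpace X] {μ : Measure X}

theorem HasKernel.hasNonnegKernel {A : L2Op μ} {k : X → X → ℝ≥0∞} (hA : HasKernel A k) :
    HasNonnegKernel μ A fun x y => (k x y).toReal where
  aemeasurable := hA.measurable.ennreal_toReal.aemeasurable
  nonneg := .of_forall fun _ => ENNReal.toReal_nonneg
  apply f := by
    filter_upwards [hA.integrable f, hA.apply_eq f] with x hx hx'
    exact ⟨hx, hx'⟩

theorem HasNonnegKernel.hasKernel [SigmaFinite μ] {A : L2Op μ} {a : X → X → ℝ}
    (hA : HasNonnegKernel μ A a) {k : X → X → ℝ≥0∞} (hk : Measurable (Function.uncurry k))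
    (hka : ∀ᵐ q : X × X ∂(μ.prod μ), k q.1 q.2 = ENNReal.ofReal (a q.1 q.2)) : HasKernel A k := by
  have h1 := Measure.ae_ae_of_ae_prod hka
  have h2 := Measure.ae_ae_of_ae_prod hA.nonneg
  refine ⟨hk, fun f => ?_, fun f => ?_⟩
  · filter_upwards [h1, h2, hA.apply f] with x hx hx' hf
    rw [lintegral_congr_ae (g := fun y => ‖(a x y : ℂ) * f y‖ₑ)]
    · exact hf.1.2.ne
    · filter_upwards [hx, hx'] with y hy hy'
      rw [hy, enorm_mul, ← ofReal_norm (a x y : ℂ), Complex.norm_real, Real.norm_of_nonneg hy']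
  · filter_upwards [h1, h2, hA.apply f] with x hx hx' hf
    rw [hf.2]
    refine integral_congr_ae ?_
    filter_upwards [hx, hx'] with y hy hy'
    rw [hy, ENNReal.toReal_ofReal hy']

theorem HasNonnegKernel.exists_hasKernel [SigmaFinite μ] {A : L2Op μ} {a : X → X → ℝ}
    (hA : HasNonnegKernel μ A a) : ∃ k : X → X → ℝ≥0∞, HasKernel A k ∧
      ∀ᵐ q : X × X ∂(μ.prod μ), k q.1 q.2 = ENNReal.ofReal (a q.1 q.2) := by
  have hm := hA.aemeasurable.ennreal_ofReal
  have hk : ∀ᵐ q : X × X ∂(μ.prod μ), hm.mk _ (q.1, q.2) = ENNReal.ofReal (a q.1 q.2) := by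
    filter_upwards [hm.ae_eq_mk] with q hq
    exact hq.symm
  exact ⟨fun x y => hm.mk _ (x, y), hA.hasKernel hm.measurable_mk hk, hk⟩

/-- The kernel of a Hadamard product of weighted operators. -/
noncomputable def hadamardKernel {m : ℕ} (α : ℝ) (k : Fin m → X → X → ℝ≥0∞) (x y : X) : ℝ≥0∞ :=
  ∏ j, k j x y ^ α

theorem measurable_hadamardKernel {m : ℕ} (α : ℝ) {k : Fin m → X → X → ℝ≥0∞}
    (hk : ∀ j, Measurable (Function.uncurry (k j))) :
    Measurable (Function.uncurry (hadamardKernel α k)) :=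
  Finset.univ.measurable_fun_prod fun j _ => (hk j).pow_const α

/-- Hadamard products in terms of measurable kernels with values in `[0, ∞]`. -/
theorem isHadamardProduct_iff [SigmaFinite μ] {m : ℕ} {α : ℝ} (hα : 0 ≤ α) {A : Fin m → L2Op μ}
    {C : L2Op μ} : IsHadamardProduct μ α A C ↔ ∃ k : Fin m → X → X → ℝ≥0∞,
      (∀ j, HasKernel (A j) (k j)) ∧ HasKernel C (hadamardKernel α k) := by
  constructor
  · rintro ⟨a, ha, hC⟩
    choose k hk hka using fun j => (ha j).exists_hasKernel
    refine ⟨k, hk, hC.hasKernel (measurable_hadamardKernel α fun j => (hk j).measurable) ?_⟩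
    filter_upwards [ae_all_iff.2 hka, ae_all_iff.2 fun j => (ha j).nonneg] with q hq hq'
    rw [ENNReal.ofReal_prod_of_nonneg fun j _ => Real.rpow_nonneg (hq' j) _]
    refine Finset.prod_congr rfl fun j _ => ?_
    rw [hq, ENNReal.ofReal_rpow_of_nonneg (hq' j) hα]
  · rintro ⟨k, hk, hC⟩
    refine ⟨fun j x y => (k j x y).toReal, fun j => (hk j).hasNonnegKernel, ?_⟩
    convert hC.hasNonnegKernel using 3 with x y
    simp [hadamardKernel, ENNReal.toReal_rpow, ENNReal.toReal_prod]

theorem isPositiveKernelOperator_iff [SigmaFinite μ] {A : L2Op μ} :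
    IsPositiveKernelOperator μ A ↔ ∃ k, HasKernel A k :=
  ⟨fun ⟨_, ha⟩ => let ⟨k, hk, _⟩ := ha.exists_hasKernel; ⟨k, hk⟩,
    fun ⟨_, hk⟩ => ⟨_, hk.hasNonnegKernel⟩⟩

/-- The integral operator with kernel `k` is bounded by `N` on the nonnegative functions in `L²`. -/
def KernelBound (μ : Measure X) (k : X → X → ℝ≥0∞) (N : ℝ≥0∞) : Prop :=
  ∀ f : X → ℝ≥0∞, AEMeasurable f μ → ∫⁻ y, f y ^ 2 ∂μ ≠ ∞ →
    ∫⁻ x, (∫⁻ y, k x y * f y ∂μ) ^ 2 ∂μ ≤ N ^ 2 * ∫⁻ y, f y ^ 2 ∂μ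

/-- A kernel of a bounded operator satisfies the norm bound for functions with values in `[0, ∞]`. -/
theorem HasKernel.kernelBound [SigmaFinite μ] {A : L2Op μ} {k : X → X → ℝ≥0∞}
    (hA : HasKernel A k) : KernelBound μ k ‖A‖ₑ := by
  intro f hf hfi
  obtain ⟨F, hF, hF'⟩ := exists_Lp_eq_toReal hf hfi
  have hFn : ∀ᵐ y ∂μ, F y = (‖F y‖ : ℂ) := by
    filter_upwards [hF] with y hy
    rw [hy, Complex.norm_real, Real.norm_of_nonneg ENNReal.toReal_nonneg]
  calc ∫⁻ x, (∫⁻ y, k x y * f y ∂μ) ^ 2 ∂μ = ∫⁻ x, ‖A F x‖ₑ ^ 2 ∂μ := by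
        refine lintegral_congr_ae ?_
        filter_upwards [hA.apply_of_nonneg hFn] with x hx
        rw [hx.2]
        congr 1
        refine lintegral_congr_ae ?_
        filter_upwards [hF'] with y hy
        rw [hy]
    _ = ‖A F‖ₑ ^ 2 := lintegral_enorm_sq _
    _ ≤ (‖A‖ₑ * ‖F‖ₑ) ^ 2 := by gcongr; exact A.le_opENorm F
    _ = ‖A‖ₑ ^ 2 * ∫⁻ y, f y ^ 2 ∂μ := by
        rw [mul_pow, ← lintegral_enorm_sq]
        congr 1
        refine lintegral_congr_ae ?_
        filter_upwards [hF'] with y hy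
        rw [hy]

theorem KernelBound.lintegral_ne_top [SigmaFinite μ] {k : X → X → ℝ≥0∞} {N : ℝ≥0∞}
    (hk : Measurable (Function.uncurry k)) (hN : N ≠ ∞) (h : KernelBound μ k N) (f : Lp ℂ 2 μ) :
    ∀ᵐ x ∂μ, ∫⁻ y, k x y * ‖f y‖ₑ ∂μ ≠ ∞ := by
  have hfe := (Lp.aestronglyMeasurable f).enorm
  have hb := h _ hfe (by rw [lintegral_enorm_sq]; finiteness)
  rw [lintegral_enorm_sq] at hb
  have hm : AEMeasurable (fun x => ∫⁻ y, k x y * ‖f y‖ₑ ∂μ) μ :=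
    AEMeasurable.lintegral_prod_right' (f := fun q : X × X => k q.1 q.2 * ‖f q.2‖ₑ)
      (hk.aemeasurable.mul (hfe.comp_quasiMeasurePreserving Measure.quasiMeasurePreserving_snd))
  filter_upwards [ae_lt_top' (hm.pow_const 2) (ne_top_of_le_ne_top (by finiteness) hb)] with x hx h'
  simp [h'] at hx

theorem HasKernel.enorm_le [SigmaFinite μ] {A : L2Op μ} {k : X → X → ℝ≥0∞} {N : ℝ≥0∞}
    (hA : HasKernel A k) (h : KernelBound μ k N) : ‖A‖ₑ ≤ N := by
  rcases eq_or_ne N ∞ with rfl | hN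
  · exact le_top
  lift N to NNReal using hN
  rw [enorm_eq_nnnorm, ENNReal.coe_le_coe]
  refine A.opNNNorm_le_bound _ fun f => ?_
  have h1 : ‖A f‖ₑ ^ 2 ≤ (N * ‖f‖ₑ) ^ 2 := by
    rw [← lintegral_enorm_sq, mul_pow, ← lintegral_enorm_sq f]
    refine le_trans (lintegral_mono_ae ?_)
      (h _ (Lp.aestronglyMeasurable f).enorm (by rw [lintegral_enorm_sq]; finiteness))
    filter_upwards [hA.enorm_apply_le f] with x hx
    gcongr
  have h2 := (ENNReal.pow_le_pow_left_iff two_ne_zero).1 h1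
  rw [enorm_eq_nnnorm, enorm_eq_nnnorm] at h2
  exact_mod_cast h2

/-- A measurable kernel which is bounded on the nonnegative functions in `L²` defines a bounded
operator on the whole of `L²`. -/
theorem KernelBound.exists_hasKernel [SigmaFinite μ] {k : X → X → ℝ≥0∞} {N : ℝ≥0∞}
    (hk : Measurable (Function.uncurry k)) (hN : N ≠ ∞) (h : KernelBound μ k N) :
    ∃ A : L2Op μ, HasKernel A k := by
  have hne := h.lintegral_ne_top hk hN
  have hint : ∀ f : Lp ℂ 2 μ, ∀ᵐ x ∂μ, Integrable (fun y => ((k x y).toReal : ℂ) * f y) μ := by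
    intro f
    filter_upwards [hne f] with x hx
    exact integrable_toReal_mul (hk.comp measurable_prodMk_left) (Lp.aestronglyMeasurable f) hx
  have hbd : ∀ f : Lp ℂ 2 μ, ∫⁻ x, ‖∫ y, ((k x y).toReal : ℂ) * f y ∂μ‖ₑ ^ 2 ∂μ ≤
      (N * ‖f‖ₑ) ^ 2 := by
    intro f
    rw [mul_pow, ← lintegral_enorm_sq f]
    refine le_trans (lintegral_mono fun x => ?_)
      (h _ (Lp.aestronglyMeasurable f).enorm (by rw [lintegral_enorm_sq]; finiteness))
    gcongr
    exact (enorm_integral_le_lintegral_enorm _).trans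
      (lintegral_mono fun y => enorm_toReal_mul_le _ _)
  have hmem : ∀ f : Lp ℂ 2 μ, MemLp (fun x => ∫ y, ((k x y).toReal : ℂ) * f y ∂μ) 2 μ := by
    intro f
    refine ⟨AEStronglyMeasurable.integral_prod_right'
      (f := fun q : X × X => ((k q.1 q.2).toReal : ℂ) * f q.2) ?_, ?_⟩
    · exact (Complex.measurable_ofReal.comp hk.ennreal_toReal).aestronglyMeasurable.mul
        ((Lp.aestronglyMeasurable f).comp_quasiMeasurePreserving
          Measure.quasiMeasurePreserving_snd)
    · rw [eLpNorm_eq_lintegral_rpow_enorm_toReal (by norm_num) (by norm_num)]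
      refine ENNReal.rpow_lt_top_of_nonneg (by simp) ?_
      simp only [ENNReal.toReal_ofNat, ENNReal.rpow_ofNat]
      exact ne_top_of_le_ne_top (by finiteness) (hbd f)
  let T : Lp ℂ 2 μ →ₗ[ℂ] Lp ℂ 2 μ :=
    { toFun := fun f => (hmem f).toLp
      map_add' := fun f g => by
        rw [← MemLp.toLp_add]
        refine MemLp.toLp_congr _ _ ?_
        filter_upwards [hint f, hint g] with x hf hg
        rw [Pi.add_apply, ← integral_add hf hg]
        refine integral_congr_ae ?_
        filter_upwards [Lp.coeFn_add f g] with y hy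
        rw [hy, Pi.add_apply, mul_add]
      map_smul' := fun c f => by
        rw [RingHom.id_apply, ← MemLp.toLp_const_smul]
        refine MemLp.toLp_congr _ _ (.of_forall fun x => ?_)
        rw [Pi.smul_apply, smul_eq_mul, ← integral_const_mul]
        refine integral_congr_ae ?_
        filter_upwards [Lp.coeFn_smul c f] with y hy
        rw [hy, Pi.smul_apply, smul_eq_mul]
        ring }
  have hT : ∀ f, ‖T f‖ ≤ N.toReal * ‖f‖ := by
    intro f
    have h1 : ‖T f‖ₑ ^ 2 ≤ (N * ‖f‖ₑ) ^ 2 := by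
      refine le_trans (le_of_eq ?_) (hbd f)
      rw [← lintegral_enorm_sq]
      refine lintegral_congr_ae ?_
      filter_upwards [(hmem f).coeFn_toLp] with x hx
      rw [← hx]
      rfl
    have h2 := ENNReal.toReal_mono (by finiteness) ((ENNReal.pow_le_pow_left_iff two_ne_zero).1 h1)
    simpa using h2
  refine ⟨T.mkContinuous N.toReal hT, hk, hne, fun f => ?_⟩
  exact (hmem f).coeFn_toLp

/-! ### Domination -/

/-- The operator `B` dominates `A`: if `|f| ≤ g`, then `|A f| ≤ B g`. Here `g = ‖g‖` says that `g` is
real and nonnegative. -/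
def Dominated (A B : L2Op μ) : Prop :=
  ∀ f g : Lp ℂ 2 μ, (∀ᵐ x ∂μ, g x = (‖g x‖ : ℂ) ∧ ‖f x‖ₑ ≤ ‖g x‖ₑ) →
    ∀ᵐ x ∂μ, B g x = (‖B g x‖ : ℂ) ∧ ‖A f x‖ₑ ≤ ‖B g x‖ₑ

theorem HasKernel.dominated [SigmaFinite μ] {A B : L2Op μ} {k l : X → X → ℝ≥0∞}
    (hA : HasKernel A k) (hB : HasKernel B l) (h : ∀ x y, k x y ≤ l x y) : Dominated A B := by
  intro f g hfg
  have hg : ∀ᵐ x ∂μ, g x = (‖g x‖ : ℂ) := hfg.mono fun x hx => hx.1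
  filter_upwards [hA.enorm_apply_le f, hB.apply_of_nonneg hg] with x hx hx'
  refine ⟨?_, ?_⟩
  · rw [hx'.1, Complex.norm_real, Real.norm_of_nonneg ENNReal.toReal_nonneg]
  · rw [hx'.2]
    refine hx.trans (lintegral_mono_ae ?_)
    filter_upwards [hfg] with y hy
    exact mul_le_mul' (h x y) hy.2

namespace Dominated

variable {A B C D : L2Op μ}

theorem one : Dominated (1 : L2Op μ) 1 := fun _ _ h => h

theorem mul (h : Dominated A B) (h' : Dominated C D) : Dominated (A * C) (B * D) :=
  fun f g hfg => h (C f) (D g) (h' f g hfg)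

theorem trans (h : Dominated A B) (h' : Dominated B C) : Dominated A C := by
  intro f g hfg
  have hg : ∀ᵐ x ∂μ, g x = (‖g x‖ : ℂ) ∧ ‖g x‖ₑ ≤ ‖g x‖ₑ := hfg.mono fun x hx => ⟨hx.1, le_rfl⟩
  filter_upwards [h f g hfg, h' g g hg] with x hx hx'
  exact ⟨hx'.1, hx.2.trans hx'.2⟩

theorem pow (h : Dominated A B) (n : ℕ) : Dominated (A ^ n) (B ^ n) := by
  induction n with
  | zero => simpa using one
  | succ n ih => rw [pow_succ, pow_succ]; exact ih.mul h

theorem nnnorm_le (h : Dominated A B) : ‖A‖₊ ≤ ‖B‖₊ := by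
  refine A.opNNNorm_le_bound _ fun f => ?_
  obtain ⟨g, -, hg, hgf⟩ := exists_Lp_eq_norm f
  have hfg : ∀ᵐ x ∂μ, g x = (‖g x‖ : ℂ) ∧ ‖f x‖ₑ ≤ ‖g x‖ₑ := by
    filter_upwards [hg, hgf] with x hx hx'
    exact ⟨hx, hx'.ge⟩
  have h1 : ‖A f‖ ≤ ‖B g‖ := by
    refine Lp.norm_le_norm_of_ae_le ?_
    filter_upwards [h f g hfg] with x hx
    exact enorm_le_iff_norm_le.1 hx.2
  have h2 : ‖g‖ ≤ ‖f‖ := by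
    refine Lp.norm_le_norm_of_ae_le ?_
    filter_upwards [hgf] with x hx
    exact enorm_le_iff_norm_le.1 hx.le
  have h3 : ‖A f‖ ≤ ‖B‖ * ‖f‖ := h1.trans ((B.le_opNorm g).trans (by gcongr))
  exact_mod_cast h3

theorem spectralRadius_le (h : Dominated A B) : spectralRadius ℂ A ≤ spectralRadius ℂ B := by
  refine le_of_tendsto_of_tendsto' (spectrum.pow_nnnorm_pow_one_div_tendsto_nhds_spectralRadius A)
    (spectrum.pow_nnnorm_pow_one_div_tendsto_nhds_spectralRadius B) fun n => ?_
  gcongr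
  exact (h.pow n).nnnorm_le

end Dominated

end Bounds

/-! ### Exponents of Hadamard products -/

section HadamardProducts

variable {X : Type*} [MeasurableSpace X] {μ : Measure X} {m : ℕ} {α : ℝ}

/-- The properties of the exponent `α` which make Hadamard products `A₁^(α) ∘ ⋯ ∘ Aₘ^(α)` well behaved:
Hölder's inequality for integrals over `X`, and the bound `‖A₁^(α) ∘ ⋯ ∘ Aₘ^(α)‖ ≤ ∏ ‖Aⱼ‖^α`. They
hold for `α = 1 / m` on every space, and for `α ≥ 1 / m` for the counting measure. -/
structure HadamardExponent (μ : Measure X) (m : ℕ) (α : ℝ) : Prop where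
  pos : 0 < α
  lintegral_le : ∀ f : Fin m → X → ℝ≥0∞, (∀ j, AEMeasurable (f j) μ) →
    ∫⁻ x, ∏ j, f j x ^ α ∂μ ≤ ∏ j, (∫⁻ x, f j x ∂μ) ^ α
  kernelBound : ∀ (k : Fin m → X → X → ℝ≥0∞) (N : Fin m → ℝ≥0∞),
    (∀ j, Measurable (Function.uncurry (k j))) → (∀ j, N j ≠ ∞) → (∀ j, KernelBound μ (k j) (N j)) →
    KernelBound μ (hadamardKernel α k) (∏ j, N j ^ α)

theorem HadamardExponent.one_div (μ : Measure X) [SigmaFinite μ] (hm : 1 ≤ m) : HadamardExponent μ m (1 / m) := by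
  have hm0 : (m : ℝ) ≠ 0 := by positivity
  have hsum : ∑ _j : Fin m, (1 / m : ℝ) = 1 := by simp [hm0]
  have hroot : ∀ a : ℝ≥0∞, ∏ _j : Fin m, a ^ (1 / m : ℝ) = a := fun a => by
    rw [Finset.prod_const, Finset.card_fin, ← ENNReal.rpow_natCast, ← ENNReal.rpow_mul,
      one_div_mul_cancel hm0, ENNReal.rpow_one]
  have hsq : ∀ a : Fin m → ℝ≥0∞, (∏ j, a j ^ (1 / m : ℝ)) ^ 2 = ∏ j, (a j ^ 2) ^ (1 / m : ℝ) := by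
    intro a
    rw [← Finset.prod_pow]
    refine Finset.prod_congr rfl fun j _ => ?_
    simp_rw [← ENNReal.rpow_natCast, ← ENNReal.rpow_mul, mul_comm]
  have hL : ∀ f : Fin m → X → ℝ≥0∞, (∀ j, AEMeasurable (f j) μ) →
      ∫⁻ x, ∏ j, f j x ^ (1 / m : ℝ) ∂μ ≤ ∏ j, (∫⁻ x, f j x ∂μ) ^ (1 / m : ℝ) := fun f hf =>
    ENNReal.lintegral_prod_norm_pow_le _ (fun j _ => hf j) hsum fun _ _ => by positivity
  refine ⟨by positivity, hL, fun k N hk _ hN f hf hfi => ?_⟩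
  have hkf : ∀ j, AEMeasurable (fun x => ∫⁻ y, k j x y * f y ∂μ) μ := fun j =>
    AEMeasurable.lintegral_prod_right' (f := fun q : X × X => k j q.1 q.2 * f q.2)
      ((hk j).aemeasurable.mul (hf.comp_quasiMeasurePreserving Measure.quasiMeasurePreserving_snd))
  calc ∫⁻ x, (∫⁻ y, hadamardKernel (1 / m) k x y * f y ∂μ) ^ 2 ∂μ
      ≤ ∫⁻ x, (∏ j, (∫⁻ y, k j x y * f y ∂μ) ^ (1 / m : ℝ)) ^ 2 ∂μ := by
        refine lintegral_mono fun x => ?_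
        gcongr
        refine le_trans (lintegral_mono fun y => le_of_eq ?_) (hL (fun j y => k j x y * f y)
          fun j => ((hk j).comp measurable_prodMk_left).aemeasurable.mul hf)
        -- distribute `f` over the factors, as `f = ∏ f ^ (1 / m)`
        conv_lhs => rw [hadamardKernel, ← hroot (f y), ← Finset.prod_mul_distrib]
        refine Finset.prod_congr rfl fun j _ => ?_
        rw [ENNReal.mul_rpow_of_nonneg _ _ (by positivity)]
    _ = ∫⁻ x, ∏ j, ((∫⁻ y, k j x y * f y ∂μ) ^ 2) ^ (1 / m : ℝ) ∂μ := by simp_rw [hsq]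
    _ ≤ ∏ j, (∫⁻ x, (∫⁻ y, k j x y * f y ∂μ) ^ 2 ∂μ) ^ (1 / m : ℝ) :=
        hL _ fun j => (hkf j).pow_const 2
    _ ≤ ∏ j, (N j ^ 2 * ∫⁻ y, f y ^ 2 ∂μ) ^ (1 / m : ℝ) := by
        gcongr with j
        exact hN j f hf hfi
    _ = (∏ j, N j ^ (1 / m : ℝ)) ^ 2 * ∫⁻ y, f y ^ 2 ∂μ := by
        conv_rhs => rw [hsq, ← hroot (∫⁻ y, f y ^ 2 ∂μ), ← Finset.prod_mul_distrib]
        refine Finset.prod_congr rfl fun j _ => ?_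
        rw [ENNReal.mul_rpow_of_nonneg _ _ (by positivity)]

theorem lintegral_count_rpow_le [MeasurableSingletonClass X] (f : X → ℝ≥0∞) {β : ℝ} (hβ : 1 ≤ β) :
    ∫⁻ x, f x ^ β ∂Measure.count ≤ (∫⁻ x, f x ∂Measure.count) ^ β := by
  have hsplit : ∀ a : ℝ≥0∞, a ^ β = a * a ^ (β - 1) := fun a => by
    conv_lhs => rw [← add_sub_cancel 1 β, ENNReal.rpow_add_of_nonneg _ _ zero_le_one (by linarith),
      ENNReal.rpow_one]
  rw [lintegral_count, lintegral_count, hsplit (∑' x, f x), ← ENNReal.tsum_mul_right]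
  refine ENNReal.tsum_le_tsum fun x => ?_
  rw [hsplit]
  gcongr
  exact ENNReal.le_tsum x

theorem KernelBound.le_of_count {R : Type*} [Countable R] [MeasurableSpace R]
    [DiscreteMeasurableSpace R] {k : R → R → ℝ≥0∞} {N : ℝ≥0∞}
    (h : KernelBound Measure.count k N) (x y : R) : k x y ≤ N := by
  classical
  have h1 := h (Pi.single y 1) (Measurable.of_discrete).aemeasurable
  simp only [lintegral_count] at h1
  have h2 : ∀ z, ∑' w, k z w * (Pi.single y 1 : R → ℝ≥0∞) w = k z y := fun z => by
    rw [tsum_eq_single y fun w hw => by simp [hw]]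
    simp
  have h3 : ∑' w, (Pi.single y 1 : R → ℝ≥0∞) w ^ 2 = 1 := by
    rw [tsum_eq_single y fun w hw => by simp [hw]]
    simp
  simp only [h2, h3, mul_one] at h1
  exact (ENNReal.pow_le_pow_left_iff two_ne_zero).1
    ((ENNReal.le_tsum x).trans (h1 ENNReal.one_ne_top))

theorem HadamardExponent.count (R : Type*) [Countable R] [MeasurableSpace R]
    [DiscreteMeasurableSpace R] (hm : 1 ≤ m) (hα : 1 / m ≤ α) :
    HadamardExponent (Measure.count : Measure R) m α := by
  have hm0 : (0 : ℝ) < m := by positivity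
  have h0 := HadamardExponent.one_div (Measure.count : Measure R) hm
  have hα0 : 0 < α := h0.pos.trans_le hα
  have hβ : 1 ≤ m * α := by rwa [div_le_iff₀ hm0, mul_comm] at hα
  have hpow : ∀ a : Fin m → ℝ≥0∞, ∏ j, a j ^ α = (∏ j, a j ^ (1 / m : ℝ)) ^ (m * α) := by
    intro a
    rw [← ENNReal.prod_rpow_of_nonneg (by positivity)]
    refine Finset.prod_congr rfl fun j _ => ?_
    rw [← ENNReal.rpow_mul]
    congr 1
    field_simp
  have hsplit : ∀ a : ℝ≥0∞, a ^ α = a ^ (α - 1 / m) * a ^ (1 / m : ℝ) := fun a => by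
    rw [← ENNReal.rpow_add_of_nonneg _ _ (by linarith) h0.pos.le, sub_add_cancel]
  refine ⟨hα0, fun f hf => ?_, fun k N hk hNt hN f hf hfi => ?_⟩
  · simp_rw [hpow]
    refine (lintegral_count_rpow_le _ hβ).trans ?_
    gcongr
    exact h0.lintegral_le f hf
  · -- the entries of the matrices are at most `N j`, which reduces the claim to the exponent `1 / m`
    have hle : ∀ x y, hadamardKernel α k x y ≤
        (∏ j, N j ^ (α - 1 / m)) * hadamardKernel (1 / m) k x y := by
      intro x y
      rw [hadamardKernel, hadamardKernel, ← Finset.prod_mul_distrib]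
      refine Finset.prod_le_prod' fun j _ => ?_
      rw [hsplit]
      gcongr
      exact (hN j).le_of_count x y
    have hfin : ∏ j, N j ^ (α - 1 / m) ≠ ∞ := ENNReal.prod_ne_top fun j _ =>
      ENNReal.rpow_ne_top_of_nonneg (by linarith) (hNt j)
    calc ∫⁻ x, (∫⁻ y, hadamardKernel α k x y * f y ∂Measure.count) ^ 2 ∂Measure.count
        ≤ ∫⁻ x, ((∏ j, N j ^ (α - 1 / m)) *
            ∫⁻ y, hadamardKernel (1 / m) k x y * f y ∂Measure.count) ^ 2 ∂Measure.count := by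
          refine lintegral_mono fun x => ?_
          rw [← lintegral_const_mul' _ _ hfin]
          gcongr ?_ ^ 2
          refine lintegral_mono fun y => ?_
          rw [← mul_assoc]
          exact mul_le_mul_left (hle x y) _
      _ = (∏ j, N j ^ (α - 1 / m)) ^ 2 * ∫⁻ x, (∫⁻ y, hadamardKernel (1 / m) k x y * f y
            ∂Measure.count) ^ 2 ∂Measure.count := by
          simp_rw [mul_pow]
          exact lintegral_const_mul' _ _ (by finiteness)
      _ ≤ (∏ j, N j ^ (α - 1 / m)) ^ 2 *
            ((∏ j, N j ^ (1 / m : ℝ)) ^ 2 * ∫⁻ y, f y ^ 2 ∂Measure.count) := by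
          gcongr
          exact h0.kernelBound k N hk hNt hN f hf hfi
      _ = (∏ j, N j ^ α) ^ 2 * ∫⁻ y, f y ^ 2 ∂Measure.count := by
          rw [← mul_assoc, ← mul_pow, ← Finset.prod_mul_distrib]
          simp_rw [← hsplit]

/-! ### Hadamard products of operators -/

namespace IsPositiveKernelOperator

variable [SigmaFinite μ] {A B : L2Op μ}

theorem mul (hA : IsPositiveKernelOperator μ A) (hB : IsPositiveKernelOperator μ B) :
    IsPositiveKernelOperator μ (A * B) := by
  obtain ⟨k, hk⟩ := isPositiveKernelOperator_iff.1 hA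
  obtain ⟨l, hl⟩ := isPositiveKernelOperator_iff.1 hB
  exact isPositiveKernelOperator_iff.2 ⟨_, hk.mul hl⟩

theorem star (hA : IsPositiveKernelOperator μ A) : IsPositiveKernelOperator μ (star A) := by
  obtain ⟨k, hk⟩ := isPositiveKernelOperator_iff.1 hA
  exact isPositiveKernelOperator_iff.2 ⟨_, hk.star⟩

/-- The product of a nonempty list of positive kernel operators is one; the empty product, the
identity, need not have a kernel. -/
theorem list_prod : ∀ {L : List (L2Op μ)}, L ≠ [] → (∀ A ∈ L, IsPositiveKernelOperator μ A) →
    IsPositiveKernelOperator μ L.prod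
  | [], h, _ => absurd rfl h
  | [A], _, h => by simpa using h A
  | A :: B :: L, _, h => by
    rw [List.prod_cons]
    exact (h A (by simp)).mul (list_prod (by simp) fun C hC => h C (List.mem_cons_of_mem _ hC))

end IsPositiveKernelOperator

theorem spectralRadius_ne_top (A : L2Op μ) : spectralRadius ℂ A ≠ ∞ :=
  ne_top_of_le_ne_top (by finiteness) (spectrum.spectralRadius_le_pow_nnnorm_pow_one_div ℂ A 0)

namespace HadamardExponent

variable [SigmaFinite μ]

theorem exists_isHadamardProduct (h : HadamardExponent μ m α) {A : Fin m → L2Op μ}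
    (hA : ∀ j, IsPositiveKernelOperator μ (A j)) : ∃ C, IsHadamardProduct μ α A C := by
  choose k hk using fun j => isPositiveKernelOperator_iff.1 (hA j)
  obtain ⟨C, hC⟩ := (h.kernelBound k (fun j => ‖A j‖ₑ) (fun j => (hk j).measurable)
    (fun j => enorm_ne_top) fun j => (hk j).kernelBound).exists_hasKernel
    (measurable_hadamardKernel α fun j => (hk j).measurable)
    (ENNReal.prod_ne_top fun j _ => ENNReal.rpow_ne_top_of_nonneg h.pos.le enorm_ne_top)
  exact ⟨C, (isHadamardProduct_iff h.pos.le).2 ⟨k, hk, hC⟩⟩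

theorem enorm_le (h : HadamardExponent μ m α) {A : Fin m → L2Op μ} {C : L2Op μ}
    (hC : IsHadamardProduct μ α A C) : ‖C‖ₑ ≤ ∏ j, ‖A j‖ₑ ^ α := by
  obtain ⟨k, hk, hC⟩ := (isHadamardProduct_iff h.pos.le).1 hC
  exact hC.enorm_le (h.kernelBound k (fun j => ‖A j‖ₑ) (fun j => (hk j).measurable)
    (fun j => enorm_ne_top) fun j => (hk j).kernelBound)

/-- The Hadamard products of `Aⱼ` and of `Bⱼ` satisfy
`(A₁^(α) ∘ ⋯ ∘ Aₘ^(α)) (B₁^(α) ∘ ⋯ ∘ Bₘ^(α)) ≤ (A₁ B₁)^(α) ∘ ⋯ ∘ (Aₘ Bₘ)^(α)`; for the kernels this is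
Hölder's inequality. -/
theorem exists_mul (h : HadamardExponent μ m α) {A B : Fin m → L2Op μ} {C D : L2Op μ}
    (hC : IsHadamardProduct μ α A C) (hD : IsHadamardProduct μ α B D) :
    ∃ E, IsHadamardProduct μ α (fun j => A j * B j) E ∧ Dominated (C * D) E := by
  obtain ⟨k, hk, hC⟩ := (isHadamardProduct_iff h.pos.le).1 hC
  obtain ⟨l, hl, hD⟩ := (isHadamardProduct_iff h.pos.le).1 hD
  have hkl := fun j => (hk j).mul (hl j)
  obtain ⟨E, hE⟩ := (h.kernelBound _ (fun j => ‖A j * B j‖ₑ) (fun j => (hkl j).measurable)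
    (fun j => enorm_ne_top) fun j => (hkl j).kernelBound).exists_hasKernel
    (measurable_hadamardKernel α fun j => (hkl j).measurable)
    (ENNReal.prod_ne_top fun j _ => ENNReal.rpow_ne_top_of_nonneg h.pos.le enorm_ne_top)
  refine ⟨E, (isHadamardProduct_iff h.pos.le).2 ⟨_, hkl, hE⟩, (hC.mul hD).dominated hE fun x y => ?_⟩
  refine le_trans (lintegral_mono fun z => le_of_eq ?_)
    (h.lintegral_le (fun j z => k j x z * l j z y) fun j =>
      (((hk j).measurable_section x).mul
        ((hl j).measurable.comp measurable_prodMk_right)).aemeasurable)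
  rw [hadamardKernel, hadamardKernel, ← Finset.prod_mul_distrib]
  refine Finset.prod_congr rfl fun j _ => ?_
  rw [ENNReal.mul_rpow_of_nonneg _ _ h.pos.le]

theorem dominated_self (h : HadamardExponent μ m α) {A : Fin m → L2Op μ} {C : L2Op μ}
    (hC : IsHadamardProduct μ α A C) : Dominated C C := by
  obtain ⟨k, -, hC⟩ := (isHadamardProduct_iff h.pos.le).1 hC
  exact hC.dominated hC fun _ _ => le_rfl

theorem exists_ofFn_prod (h : HadamardExponent μ m α) : ∀ {n : ℕ} (_ : n ≠ 0)
    {A : Fin n → Fin m → L2Op μ} {C : Fin n → L2Op μ} (_ : ∀ i, IsHadamardProduct μ α (A i) (C i)),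
    ∃ E, IsHadamardProduct μ α (fun j => (List.ofFn fun i => A i j).prod) E ∧
      Dominated (List.ofFn C).prod E
  | 0, hn, _, _, _ => absurd rfl hn
  | 1, _, A, C, hC => ⟨C 0, by simpa using hC 0, by simpa using h.dominated_self (hC 0)⟩
  | n + 2, _, A, C, hC => by
    obtain ⟨E', hE', hdom'⟩ := h.exists_ofFn_prod (n := n + 1) (by simp)
      (A := fun i => A i.succ) (C := fun i => C i.succ) fun i => hC i.succ
    obtain ⟨E, hE, hdom⟩ := h.exists_mul (hC 0) hE'
    refine ⟨E, ?_, ?_⟩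
    · simp_rw [List.ofFn_succ (n := n + 1), List.prod_cons]
      exact hE
    · rw [List.ofFn_succ (n := n + 1), List.prod_cons]
      exact ((h.dominated_self (hC 0)).mul hdom').trans hdom

theorem enorm_ofFn_prod_le (h : HadamardExponent μ m α) {n : ℕ} (hn : n ≠ 0)
    {A : Fin n → Fin m → L2Op μ} {C : Fin n → L2Op μ} (hC : ∀ i, IsHadamardProduct μ α (A i) (C i)) :
    ‖(List.ofFn C).prod‖ₑ ≤ ∏ j, ‖(List.ofFn fun i => A i j).prod‖ₑ ^ α := by
  obtain ⟨E, hE, hdom⟩ := h.exists_ofFn_prod hn hC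
  exact (enorm_le_iff_norm_le.2 hdom.nnnorm_le).trans (h.enorm_le hE)

theorem spectralRadius_le (h : HadamardExponent μ m α) {A : Fin m → L2Op μ} {C : L2Op μ}
    (hC : IsHadamardProduct μ α A C) : spectralRadius ℂ C ≤ ∏ j, spectralRadius ℂ (A j) ^ α := by
  have hA := fun j =>
    (spectrum.pow_nnnorm_pow_one_div_tendsto_nhds_spectralRadius (A j)).ennrpow_const α
  refine le_of_tendsto_of_tendsto (spectrum.pow_nnnorm_pow_one_div_tendsto_nhds_spectralRadius C)
    (ENNReal.tendsto_finsetProd_of_ne_top _ (fun j _ => hA j) fun j _ =>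
      ENNReal.rpow_ne_top_of_nonneg h.pos.le (spectralRadius_ne_top (A j))) ?_
  filter_upwards [eventually_ne_atTop 0] with n hn
  have key := h.enorm_ofFn_prod_le hn (A := fun _ => A) (C := fun _ => C) fun _ => hC
  simp only [List.ofFn_const, List.prod_replicate, enorm_eq_nnnorm] at key
  calc (‖C ^ n‖₊ : ℝ≥0∞) ^ (1 / n : ℝ) ≤ (∏ j, (‖A j ^ n‖₊ : ℝ≥0∞) ^ α) ^ (1 / n : ℝ) := by gcongr
    _ = ∏ j, ((‖A j ^ n‖₊ : ℝ≥0∞) ^ (1 / n : ℝ)) ^ α := by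
      rw [← ENNReal.prod_rpow_of_nonneg (by positivity)]
      refine Finset.prod_congr rfl fun j _ => ?_
      rw [← ENNReal.rpow_mul, ← ENNReal.rpow_mul, mul_comm]

theorem isHadamardProduct_star (h : HadamardExponent μ m α) {A : Fin m → L2Op μ} {C : L2Op μ}
    (hC : IsHadamardProduct μ α A C) : IsHadamardProduct μ α (fun j => star (A j)) (star C) := by
  obtain ⟨k, hk, hC⟩ := (isHadamardProduct_iff h.pos.le).1 hC
  exact (isHadamardProduct_iff h.pos.le).2 ⟨_, fun j => (hk j).star, hC.star⟩

end HadamardExponent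

theorem IsHadamardProduct.comp_perm {A : Fin m → L2Op μ} {C : L2Op μ}
    (hC : IsHadamardProduct μ α A C) (σ : Equiv.Perm (Fin m)) :
    IsHadamardProduct μ α (fun j => A (σ j)) C := by
  obtain ⟨a, ha, hC⟩ := hC
  refine ⟨fun j => a (σ j), fun j => ha (σ j), ?_⟩
  convert hC using 3 with x y
  exact Equiv.prod_comp σ fun j => a j x y ^ α

end HadamardProducts

/-! ### Growth rates of sequences -/

theorem limsup_rpow_one_div_le {u : ℕ → ℝ≥0∞} {C t : ℝ≥0∞} (hC : C ≠ ∞)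
    (h : ∀ᶠ n in atTop, u n ≤ C * t ^ n) :
    limsup (fun n : ℕ => u n ^ ((1 : ℝ) / n)) atTop ≤ t := by
  have hC1 : Tendsto (fun n : ℕ => max C 1 ^ ((1 : ℝ) / n)) atTop (nhds 1) := by
    have h0 : max C 1 ≠ 0 := (zero_lt_one.trans_le (le_max_right C 1)).ne'
    have h1 : max C 1 ≠ ∞ := by simp [hC]
    lift max C 1 to NNReal using h1 with c
    have hc : c ≠ 0 := by simpa using h0
    have h2 : Tendsto (fun n : ℕ => c ^ ((1 : ℝ) / n)) atTop (nhds (c ^ (0 : ℝ))) :=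
      tendsto_const_nhds.nnrpow tendsto_one_div_atTop_nhds_zero_nat (Or.inl hc)
    rw [NNReal.rpow_zero] at h2
    have h3 := ENNReal.tendsto_coe.2 h2
    simpa [ENNReal.coe_rpow_of_ne_zero hc] using h3
  have hlim : Tendsto (fun n : ℕ => max C 1 ^ ((1 : ℝ) / n) * t) atTop (nhds t) := by
    simpa using ENNReal.Tendsto.mul_const hC1 (Or.inl one_ne_zero) (b := t)
  rw [← hlim.limsup_eq]
  refine limsup_le_limsup ?_
  filter_upwards [h, eventually_ne_atTop 0] with n hn hn0
  have hn0' : (n : ℝ) ≠ 0 := by exact_mod_cast hn0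
  calc u n ^ ((1 : ℝ) / n) ≤ (max C 1 * t ^ n) ^ ((1 : ℝ) / n) := by
        gcongr
        exact hn.trans (by gcongr; exact le_max_left _ _)
    _ = max C 1 ^ ((1 : ℝ) / n) * t := by
        rw [ENNReal.mul_rpow_of_nonneg _ _ (by positivity), ← ENNReal.rpow_natCast,
          ← ENNReal.rpow_mul, mul_one_div_cancel hn0', ENNReal.rpow_one]

/-- To bound the growth rate of `u` by `L^p` it suffices to bound `u` geometrically with ratio `t^p` for
every finite `t > L`. -/
theorem limsup_rpow_one_div_le_rpow {u : ℕ → ℝ≥0∞} {L : ℝ≥0∞} {p : ℝ} (hp : 0 < p)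
    (h : ∀ t, L < t → t ≠ ∞ → ∃ C ≠ ∞, ∀ᶠ n in atTop, u n ≤ C * (t ^ p) ^ n) :
    limsup (fun n : ℕ => u n ^ ((1 : ℝ) / n)) atTop ≤ L ^ p := by
  rw [← ENNReal.rpow_inv_le_iff hp]
  refine le_of_forall_gt_imp_ge_of_dense fun t ht => ?_
  rcases eq_or_ne t ∞ with rfl | ht'
  · exact le_top
  obtain ⟨C, hC, hCu⟩ := h t ht ht'
  rw [ENNReal.rpow_inv_le_iff hp]
  exact limsup_rpow_one_div_le hC hCu

theorem eventually_le_pow_of_limsup_lt {v : ℕ → ℝ≥0∞} {t : ℝ≥0∞}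
    (h : limsup (fun n : ℕ => v n ^ ((1 : ℝ) / n)) atTop < t) : ∀ᶠ n in atTop, v n ≤ t ^ n := by
  filter_upwards [eventually_lt_of_limsup_lt h, eventually_ne_atTop 0] with n hn hn0
  have hn0' : (0 : ℝ) < n := by positivity
  rw [one_div] at hn
  have := (ENNReal.rpow_inv_le_iff hn0').1 hn.le
  rwa [ENNReal.rpow_natCast] at this

/-! ### Norms and spectral radii of sets of operators -/

section SetRadius

variable {E : Type*} [NormedAddCommGroup E] [NormedSpace ℂ E] {Ψ Φ : Set (E →L[ℂ] E)}

theorem enorm_le_setNorm {A : E →L[ℂ] E} (hA : A ∈ Ψ) : ‖A‖ₑ ≤ setNorm Ψ :=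
  le_iSup₂ (f := fun (A : E →L[ℂ] E) (_ : A ∈ Ψ) => ‖A‖ₑ) A hA

theorem setNorm_le {N : ℝ≥0∞} (h : ∀ A ∈ Ψ, ‖A‖ₑ ≤ N) : setNorm Ψ ≤ N := iSup₂_le h

theorem setNorm_ne_top (h : Bornology.IsBounded Ψ) : setNorm Ψ ≠ ∞ := by
  obtain ⟨C, hC⟩ := h.exists_norm_le
  refine ne_top_of_le_ne_top (ENNReal.ofReal_ne_top (r := C)) (setNorm_le fun A hA => ?_)
  rw [← ofReal_norm]
  exact ENNReal.ofReal_le_ofReal (hC A hA)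

theorem setNorm_mul_le (Ψ Φ : Set (E →L[ℂ] E)) : setNorm (Ψ * Φ) ≤ setNorm Ψ * setNorm Φ := by
  refine setNorm_le ?_
  rintro _ ⟨A, hA, B, hB, rfl⟩
  have hAB : ‖A * B‖ₑ ≤ ‖A‖ₑ * ‖B‖ₑ := by
    simp only [enorm_eq_nnnorm]
    exact_mod_cast nnnorm_mul_le A B
  refine hAB.trans ?_
  gcongr
  exacts [enorm_le_setNorm hA, enorm_le_setNorm hB]

theorem setNorm_one_le : setNorm (1 : Set (E →L[ℂ] E)) ≤ 1 := by
  refine setNorm_le ?_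
  rintro _ rfl
  rw [← ofReal_norm, ENNReal.ofReal_le_one]
  exact ContinuousLinearMap.norm_id_le

theorem setNorm_pow_le (Ψ : Set (E →L[ℂ] E)) (n : ℕ) : setNorm (Ψ ^ n) ≤ setNorm Ψ ^ n := by
  induction n with
  | zero => simpa using setNorm_one_le
  | succ n ih =>
    rw [pow_succ, pow_succ]
    exact (setNorm_mul_le _ _).trans (by gcongr)

theorem setNorm_list_prod_ne_top {L : List (Set (E →L[ℂ] E))} (h : ∀ Ψ ∈ L, setNorm Ψ ≠ ∞) :
    setNorm L.prod ≠ ∞ := by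
  induction L with
  | nil => exact ne_top_of_le_ne_top ENNReal.one_ne_top setNorm_one_le
  | cons Ψ L ih =>
    rw [List.prod_cons]
    refine ne_top_of_le_ne_top (ENNReal.mul_ne_top (h Ψ (by simp)) ?_) (setNorm_mul_le _ _)
    exact ih fun Φ hΦ => h Φ (List.mem_cons_of_mem _ hΦ)

/-- If `‖Ψ^q‖ ≤ s^q` for a single `q ≥ 1`, then `‖Ψⁿ‖` grows at most like `sⁿ`. -/
theorem exists_setNorm_pow_le (hΨ : setNorm Ψ ≠ ∞) {q : ℕ} {s : ℝ≥0∞} (hs0 : s ≠ 0)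
    (hs : s ≠ ∞) (hq : q ≠ 0) (h : setNorm (Ψ ^ q) ≤ s ^ q) :
    ∃ C ≠ ∞, ∀ n, setNorm (Ψ ^ n) ≤ C * s ^ n := by
  refine ⟨max 1 (setNorm Ψ / s) ^ q, ?_, fun n => ?_⟩
  · have : setNorm Ψ / s ≠ ∞ := ENNReal.div_ne_top hΨ hs0
    exact ENNReal.pow_ne_top (by simp [this])
  · calc setNorm (Ψ ^ n) = setNorm ((Ψ ^ q) ^ (n / q) * Ψ ^ (n % q)) := by
          rw [← pow_mul, ← pow_add, Nat.div_add_mod]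
      _ ≤ setNorm (Ψ ^ q) ^ (n / q) * setNorm Ψ ^ (n % q) := by
          refine (setNorm_mul_le _ _).trans ?_
          gcongr <;> exact setNorm_pow_le _ _
      _ ≤ (s ^ q) ^ (n / q) * (max 1 (setNorm Ψ / s) ^ q * s ^ (n % q)) := by
          gcongr
          calc setNorm Ψ ^ (n % q) = (setNorm Ψ / s) ^ (n % q) * s ^ (n % q) := by
                rw [← mul_pow, ENNReal.div_mul_cancel hs0 hs]
            _ ≤ max 1 (setNorm Ψ / s) ^ (n % q) * s ^ (n % q) := by
                gcongr
                exact le_max_right _ _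
            _ ≤ _ := by
                gcongr
                · exact le_max_left _ _
                · exact (Nat.mod_lt n (Nat.pos_of_ne_zero hq)).le
      _ = max 1 (setNorm Ψ / s) ^ q * s ^ n := by
          rw [mul_left_comm, ← pow_mul, ← pow_add, Nat.div_add_mod]

theorem spectralRadius_mul_comm_le (A B : E →L[ℂ] E) :
    spectralRadius ℂ (A * B) ≤ spectralRadius ℂ (B * A) := by
  refine iSup₂_le fun z hz => ?_
  rcases eq_or_ne z 0 with rfl | hz0
  · simp
  have : z ∈ spectrum ℂ (B * A) \ {0} := spectrum.nonzero_mul_comm (𝕜 := ℂ) A B ▸ ⟨hz, hz0⟩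
  exact le_iSup₂ (f := fun (z : ℂ) (_ : z ∈ spectrum ℂ (B * A)) => (‖z‖₊ : ℝ≥0∞)) z this.1

/-- In contrast to `spectrum.spectralRadius_le_nnnorm`, this covers the trivial space, where `‖1‖ = 0`. -/
theorem spectralRadius_le_enorm [CompleteSpace E] (A : E →L[ℂ] E) : spectralRadius ℂ A ≤ ‖A‖ₑ := by
  refine le_of_tendsto (spectrum.pow_nnnorm_pow_one_div_tendsto_nhds_spectralRadius A) ?_
  filter_upwards [eventually_ne_atTop 0] with n hn
  have hn0' : (0 : ℝ) < n := by positivity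
  rw [one_div, ENNReal.rpow_inv_le_iff hn0', ENNReal.rpow_natCast, enorm_eq_nnnorm]
  exact_mod_cast nnnorm_pow_le' A (Nat.pos_of_ne_zero hn)

theorem spectralRadius_le_generalizedSpectralRadius {A : E →L[ℂ] E} (hA : A ∈ Ψ) :
    spectralRadius ℂ A ≤ generalizedSpectralRadius Ψ := by
  rw [← limsup_const (f := (atTop : Filter ℕ)) (spectralRadius ℂ A)]
  refine limsup_le_limsup ?_
  filter_upwards [eventually_ne_atTop 0] with n hn
  have hn0' : (0 : ℝ) < n := by positivity
  rw [one_div, ENNReal.le_rpow_inv_iff hn0', ENNReal.rpow_natCast]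
  exact (spectrum.spectralRadius_pow_le A n hn).trans
    (le_iSup₂ (f := fun (B : E →L[ℂ] E) (_ : B ∈ Ψ ^ n) => spectralRadius ℂ B) (A ^ n)
      (Set.pow_mem_pow hA))

theorem generalizedSpectralRadius_le_jointSpectralRadius [CompleteSpace E]
    (Ψ : Set (E →L[ℂ] E)) : generalizedSpectralRadius Ψ ≤ jointSpectralRadius Ψ := by
  refine limsup_le_limsup (.of_forall fun n => ?_)
  dsimp only
  gcongr
  exact iSup₂_le fun A hA => (spectralRadius_le_enorm A).trans (enorm_le_setNorm hA)

theorem mul_pow_succ_eq {M : Type*} [Monoid M] (a b : M) (n : ℕ) :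
    (a * b) ^ (n + 1) = a * (b * a) ^ n * b := by
  rw [pow_succ, ← mul_assoc, mul_pow_mul]

theorem generalizedSpectralRadius_mul_comm_le (Ψ Φ : Set (E →L[ℂ] E)) :
    generalizedSpectralRadius (Ψ * Φ) ≤ generalizedSpectralRadius (Φ * Ψ) := by
  refine limsup_le_limsup ?_
  filter_upwards [eventually_ne_atTop 0] with n hn
  obtain ⟨n, rfl⟩ := Nat.exists_eq_succ_of_ne_zero hn
  refine ENNReal.rpow_le_rpow (iSup₂_le fun A hA => ?_) (by positivity)
  rw [Nat.succ_eq_add_one, mul_pow_succ_eq] at hA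
  obtain ⟨P, hP, Q, hQ, rfl⟩ := hA
  refine (spectralRadius_mul_comm_le P Q).trans
    (le_iSup₂ (f := fun (B : E →L[ℂ] E) (_ : B ∈ (Φ * Ψ) ^ (n + 1)) => spectralRadius ℂ B) (Q * P) ?_)
  rw [pow_succ', mul_assoc]
  exact Set.mul_mem_mul hQ hP

/-- `(Ψ Φ)^(n + 1) = Ψ (Φ Ψ)ⁿ Φ`, and the constant `‖Ψ‖ ‖Φ‖` does not affect the growth rate. -/
theorem jointSpectralRadius_mul_comm_le (hΨ : setNorm Ψ ≠ ∞) (hΦ : setNorm Φ ≠ ∞) :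
    jointSpectralRadius (Ψ * Φ) ≤ jointSpectralRadius (Φ * Ψ) := by
  rw [← ENNReal.rpow_one (jointSpectralRadius (Φ * Ψ))]
  refine limsup_rpow_one_div_le_rpow one_pos fun t ht htt => ?_
  have ht0 : t ≠ 0 := (zero_le.trans_lt ht).ne'
  refine ⟨setNorm Ψ * setNorm Φ / t, ENNReal.div_ne_top (ENNReal.mul_ne_top hΨ hΦ) ht0, ?_⟩
  obtain ⟨N, hN⟩ := eventually_atTop.1 (eventually_le_pow_of_limsup_lt ht)
  filter_upwards [eventually_ge_atTop (N + 1)] with n hn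
  obtain ⟨n, rfl⟩ := Nat.exists_eq_add_of_lt (Nat.lt_of_succ_le hn)
  rw [mul_pow_succ_eq, ENNReal.rpow_one]
  calc setNorm (Ψ * (Φ * Ψ) ^ (N + n) * Φ) ≤ setNorm Ψ * t ^ (N + n) * setNorm Φ := by
        refine (setNorm_mul_le _ _).trans ?_
        gcongr
        refine (setNorm_mul_le _ _).trans ?_
        gcongr
        exact hN _ (by omega)
    _ = setNorm Ψ * setNorm Φ / t * (t ^ (N + n) * t) := by
        rw [mul_comm _ t, ← mul_assoc, ENNReal.div_mul_cancel ht0 htt]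
        ring
    _ = _ := by rw [pow_succ]

end SetRadius

/-! ### Comparison of spectral radii of sets -/

section Comparison

variable {X : Type*} [MeasurableSpace X] {μ : Measure X} {m : ℕ} {α : ℝ}

theorem exists_dominated_pow {Ψ Φ : Set (L2Op μ)} (h : ∀ A ∈ Ψ, ∃ B ∈ Φ, Dominated A B) (n : ℕ) :
    ∀ A ∈ Ψ ^ n, ∃ B ∈ Φ ^ n, Dominated A B := by
  induction n with
  | zero =>
    rintro A rfl
    exact ⟨1, rfl, .one⟩
  | succ n ih =>
    rintro A hA
    rw [pow_succ] at hA
    obtain ⟨P, hP, Q, hQ, rfl⟩ := hA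
    obtain ⟨P', hP', hPP'⟩ := ih P hP
    obtain ⟨Q', hQ', hQQ'⟩ := h Q hQ
    exact ⟨P' * Q', pow_succ Φ n ▸ Set.mul_mem_mul hP' hQ', hPP'.mul hQQ'⟩

/-- Powers of a single operator suffice here: `ρ(A)^m ≤ ρ(A^m)`, and `A^m ∈ (Ψ^m)ⁿ` for `A ∈ Ψⁿ`. -/
theorem generalizedSpectralRadius_le_of_dominated {Ψ Φ : Set (L2Op μ)} (hm : m ≠ 0)
    (h : ∀ A ∈ Ψ ^ m, ∃ B ∈ Φ, Dominated A B) :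
    generalizedSpectralRadius Ψ ≤ generalizedSpectralRadius Φ ^ (1 / m : ℝ) := by
  have hm0 : (0 : ℝ) < m := by positivity
  refine limsup_rpow_one_div_le_rpow (by positivity) fun t ht _ => ⟨1, ENNReal.one_ne_top, ?_⟩
  filter_upwards [eventually_le_pow_of_limsup_lt ht] with n hn
  rw [one_mul]
  refine iSup₂_le fun A hA => ?_
  have hAm : A ^ m ∈ (Ψ ^ m) ^ n := by
    rw [← pow_mul, mul_comm, pow_mul]
    exact Set.pow_mem_pow hA
  obtain ⟨B, hB, hAB⟩ := exists_dominated_pow h n _ hAm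
  have key : spectralRadius ℂ A ^ m ≤ t ^ n :=
    (spectrum.spectralRadius_pow_le A m hm).trans <| hAB.spectralRadius_le.trans <|
      (le_iSup₂ (f := fun (B : L2Op μ) (_ : B ∈ Φ ^ n) => spectralRadius ℂ B) B hB).trans hn
  rw [← ENNReal.rpow_natCast, ← ENNReal.rpow_mul, mul_comm, ENNReal.rpow_mul, one_div,
    ENNReal.le_rpow_inv_iff hm0]
  simpa using key

/-- Here `Ψ` has to be bounded, since the domination controls only the norms `‖Ψ^(m n)‖`. -/
theorem jointSpectralRadius_le_of_dominated {Ψ Φ : Set (L2Op μ)} (hm : m ≠ 0)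
    (hΨ : setNorm Ψ ≠ ∞) (h : ∀ A ∈ Ψ ^ m, ∃ B ∈ Φ, Dominated A B) :
    jointSpectralRadius Ψ ≤ jointSpectralRadius Φ ^ (1 / m : ℝ) := by
  have hm0 : (0 : ℝ) < m := by positivity
  refine limsup_rpow_one_div_le_rpow (by positivity) fun t ht htt => ?_
  obtain ⟨n, hn, hn0⟩ :=
    ((eventually_le_pow_of_limsup_lt ht).and (eventually_ne_atTop 0)).exists
  have ht0 : t ≠ 0 := (zero_le.trans_lt ht).ne'
  have hroot : (t ^ (1 / m : ℝ)) ^ (m * n) = t ^ n := by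
    rw [pow_mul, ← ENNReal.rpow_natCast (t ^ (1 / m : ℝ)), ← ENNReal.rpow_mul,
      one_div_mul_cancel hm0.ne', ENNReal.rpow_one]
  have hle : setNorm (Ψ ^ (m * n)) ≤ (t ^ (1 / m : ℝ)) ^ (m * n) := by
    rw [hroot, pow_mul]
    refine le_trans (setNorm_le fun A hA => ?_) hn
    obtain ⟨B, hB, hAB⟩ := exists_dominated_pow h n A hA
    exact (enorm_le_iff_norm_le.2 hAB.nnnorm_le).trans (enorm_le_setNorm hB)
  obtain ⟨C, hC, hCn⟩ := exists_setNorm_pow_le hΨ (by simp [ht0, htt])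
    (ENNReal.rpow_ne_top_of_nonneg (by positivity) htt) (mul_ne_zero hm hn0) hle
  exact ⟨C, hC, .of_forall hCn⟩

/-! ### Cyclic shifts -/

theorem cyclicProduct_eq_rotate_prod {M : Type*} [Monoid M] (Θ : Fin m → M) (j : Fin m) :
    cyclicProduct Θ j = ((List.ofFn Θ).rotate j).prod := by
  rw [cyclicProduct]
  congr 1
  refine List.ext_getElem (by simp) fun i h1 h2 => ?_
  simp only [List.getElem_ofFn, List.getElem_rotate, List.length_ofFn]
  congr 1
  ext
  simp [Fin.val_add, add_comm]

/-- Neither spectral radius changes under a cyclic shift of the factors of a product of bounded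
sets. -/
theorem radius_cyclicProduct_le {r : Set (L2Op μ) → ℝ≥0∞}
    (hr : r ∈ ({generalizedSpectralRadius, jointSpectralRadius} : Set (Set (L2Op μ) → ℝ≥0∞)))
    {Θ : Fin m → Set (L2Op μ)} (hΘ : ∀ j, setNorm (Θ j) ≠ ∞) (j : Fin m) :
    r (cyclicProduct Θ j) ≤ r (List.ofFn Θ).prod := by
  have hL : ∀ Ψ ∈ List.ofFn Θ, setNorm Ψ ≠ ∞ := by
    intro Ψ hΨ
    obtain ⟨i, rfl⟩ := (List.mem_ofFn' _ _).1 hΨ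
    exact hΘ i
  rw [cyclicProduct_eq_rotate_prod, List.rotate_eq_drop_append_take (by simp),
    List.prod_append]
  conv_rhs => rw [← List.take_append_drop j (List.ofFn Θ), List.prod_append]
  rcases hr with rfl | rfl
  · exact generalizedSpectralRadius_mul_comm_le _ _
  · exact jointSpectralRadius_mul_comm_le
      (setNorm_list_prod_ne_top fun Ψ h => hL Ψ (List.mem_of_mem_drop h))
      (setNorm_list_prod_ne_top fun Ψ h => hL Ψ (List.mem_of_mem_take h))

/-! ### Sets of Hadamard products -/

/-- An element of `(Φ₁^(α) ∘ ⋯ ∘ Φₘ^(α))ⁿ` is a product of Hadamard products, and collecting the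
factors with the same index `j` gives an element of `Φⱼⁿ`. -/
theorem exists_of_mem_hadamardSet_pow {Φ : Fin m → Set (L2Op μ)} {n : ℕ} {D : L2Op μ}
    (hD : D ∈ hadamardSet μ α Φ ^ n) : ∃ (A : Fin n → Fin m → L2Op μ) (C : Fin n → L2Op μ),
      (∀ i, IsHadamardProduct μ α (A i) (C i)) ∧ (List.ofFn C).prod = D ∧
      (∀ i j, A i j ∈ Φ j) ∧ ∀ j, (List.ofFn fun i => A i j).prod ∈ Φ j ^ n := by
  obtain ⟨C, rfl⟩ := Set.mem_pow.1 hD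
  choose A hA hAC using fun i => (C i).2
  exact ⟨A, fun i => C i, hAC, rfl, hA, fun j => Set.mem_pow.2 ⟨fun i => ⟨A i j, hA i j⟩, rfl⟩⟩

theorem HadamardExponent.prod_rpow_le (h : HadamardExponent μ m α) {u : Fin m → ℝ≥0∞} {t : ℝ≥0∞}
    {n : ℕ} (hu : ∀ j, u j ≤ t ^ n) : ∏ j, u j ^ α ≤ (t ^ (m * α)) ^ n := by
  calc ∏ j, u j ^ α ≤ ∏ _j : Fin m, (t ^ n) ^ α :=
        Finset.prod_le_prod' fun j _ => ENNReal.rpow_le_rpow (hu j) h.pos.le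
    _ = (t ^ (m * α)) ^ n := by
        rw [Finset.prod_const, Finset.card_fin]
        simp_rw [← ENNReal.rpow_natCast, ← ENNReal.rpow_mul]
        congr 1
        ring

variable [SigmaFinite μ]

theorem HadamardExponent.setNorm_hadamardSet_ne_top (h : HadamardExponent μ m α)
    {Φ : Fin m → Set (L2Op μ)} (hΦ : ∀ j, setNorm (Φ j) ≠ ∞) :
    setNorm (hadamardSet μ α Φ) ≠ ∞ := by
  refine ne_top_of_le_ne_top (ENNReal.prod_ne_top (s := Finset.univ) fun j _ =>
    ENNReal.rpow_ne_top_of_nonneg h.pos.le (hΦ j)) (setNorm_le ?_)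
  rintro C ⟨A, hA, hC⟩
  refine (h.enorm_le hC).trans (Finset.prod_le_prod' fun j _ => ?_)
  exact ENNReal.rpow_le_rpow (enorm_le_setNorm (hA j)) h.pos.le

theorem HadamardExponent.jointSpectralRadius_le (h : HadamardExponent μ m α) (hm : m ≠ 0)
    {Φ : Fin m → Set (L2Op μ)} {L : ℝ≥0∞} (hL : ∀ j, jointSpectralRadius (Φ j) ≤ L) :
    jointSpectralRadius (hadamardSet μ α Φ) ≤ L ^ (m * α) := by
  have hp := h.pos
  refine limsup_rpow_one_div_le_rpow (by positivity) fun t ht _ => ⟨1, ENNReal.one_ne_top, ?_⟩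
  filter_upwards [eventually_all.2 fun j => eventually_le_pow_of_limsup_lt ((hL j).trans_lt ht),
    eventually_ne_atTop 0] with n hn hn0
  rw [one_mul]
  refine setNorm_le fun D hD => ?_
  obtain ⟨A, C, hAC, rfl, -, hA⟩ := exists_of_mem_hadamardSet_pow hD
  exact (h.enorm_ofFn_prod_le hn0 hAC).trans
    (h.prod_rpow_le fun j => (enorm_le_setNorm (hA j)).trans (hn j))

theorem HadamardExponent.generalizedSpectralRadius_le (h : HadamardExponent μ m α) (hm : m ≠ 0)
    {Φ : Fin m → Set (L2Op μ)} {L : ℝ≥0∞} (hL : ∀ j, generalizedSpectralRadius (Φ j) ≤ L) :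
    generalizedSpectralRadius (hadamardSet μ α Φ) ≤ L ^ (m * α) := by
  have hp := h.pos
  refine limsup_rpow_one_div_le_rpow (by positivity) fun t ht _ => ⟨1, ENNReal.one_ne_top, ?_⟩
  filter_upwards [eventually_all.2 fun j => eventually_le_pow_of_limsup_lt ((hL j).trans_lt ht),
    eventually_ne_atTop 0] with n hn hn0
  rw [one_mul]
  refine iSup₂_le fun D hD => ?_
  obtain ⟨A, C, hAC, rfl, -, hA⟩ := exists_of_mem_hadamardSet_pow hD
  obtain ⟨E, hE, hdom⟩ := h.exists_ofFn_prod hn0 hAC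
  refine (hdom.spectralRadius_le.trans (h.spectralRadius_le hE)).trans (h.prod_rpow_le fun j => ?_)
  exact (le_iSup₂ (f := fun (B : L2Op μ) (_ : B ∈ Φ j ^ n) => spectralRadius ℂ B) _ (hA j)).trans
    (hn j)

/-- A product `D₁ ⋯ Dₘ` of Hadamard products of elements of `Θ₁, …, Θₘ` is dominated by a Hadamard
product of elements of the cyclic shifts of `Θ₁ ⋯ Θₘ`: shift the factors of `Dₖ` cyclically by `k`
before multiplying. -/
theorem HadamardExponent.exists_dominated_cyclicProduct (h : HadamardExponent μ m α) (hm : m ≠ 0)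
    (Θ : Fin m → Set (L2Op μ)) : ∀ D ∈ hadamardSet μ α Θ ^ m,
      ∃ E ∈ hadamardSet μ α (cyclicProduct Θ), Dominated D E := by
  have : NeZero m := ⟨hm⟩
  intro D hD
  obtain ⟨A, C, hAC, rfl, hA, -⟩ := exists_of_mem_hadamardSet_pow hD
  obtain ⟨E, hE, hdom⟩ := h.exists_ofFn_prod hm (A := fun i j => A i (j + i)) (C := C)
    fun i => (hAC i).comp_perm (Equiv.addRight i)
  refine ⟨E, ⟨_, fun j => ?_, hE⟩, hdom⟩
  exact Set.mem_prod_list_ofFn.2 ⟨fun i => ⟨A i (j + i), hA i (j + i)⟩, rfl⟩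

/-! ### The chain of inequalities -/

/-- For a Hadamard product `C` of elements of the `Ψⱼ`, `‖C‖² = ρ(C* C)`, and `C* C` is dominated by a
Hadamard product of elements of the `Ψ_{τ(j)}* Ψ_{ν(j)}`. -/
theorem HadamardExponent.setNorm_hadamardSet_le (h : HadamardExponent μ m α)
    (Ψ : Fin m → Set (L2Op μ)) (τ ν : Equiv.Perm (Fin m)) :
    setNorm (hadamardSet μ α Ψ) ≤
      generalizedSpectralRadius (hadamardSet μ α (adjointProduct Ψ τ ν)) ^ (1 / 2 : ℝ) := by
  refine setNorm_le ?_
  rintro C ⟨A, hA, hC⟩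
  obtain ⟨E, hE, hdom⟩ := h.exists_mul ((h.isHadamardProduct_star hC).comp_perm τ) (hC.comp_perm ν)
  have hmem : E ∈ hadamardSet μ α (adjointProduct Ψ τ ν) :=
    ⟨_, fun j => Set.mul_mem_mul (Set.star_mem_star.2 (hA (τ j))) (hA (ν j)), hE⟩
  have hsq : ‖C‖ₑ ^ 2 = spectralRadius ℂ (star C * C) := by
    rw [(IsSelfAdjoint.star_mul_self C).spectralRadius_eq_nnnorm, CStarRing.nnnorm_star_mul_self,
      ENNReal.coe_mul, sq]
    rfl
  rw [_root_.one_div, ENNReal.le_rpow_inv_iff two_pos, ENNReal.rpow_two, hsq]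
  exact hdom.spectralRadius_le.trans (spectralRadius_le_generalizedSpectralRadius hmem)

/-- The whole chain of inequalities, for any exponent which satisfies `HadamardExponent`. Both parts of
`theorem3p13` are instances of it. -/
theorem HadamardExponent.radius_chain (h : HadamardExponent μ m α) (hm : 1 ≤ m)
    (τ ν : Equiv.Perm (Fin m)) (Ψ : Fin m → Set (L2Op μ)) (hb : ∀ j, Bornology.IsBounded (Ψ j))
    (hΨ : ∀ j, ∀ A ∈ Ψ j, IsPositiveKernelOperator μ A) :
    HadamardDefined μ α Ψ ∧ HadamardDefined μ α (adjointProduct Ψ τ ν) ∧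
      HadamardDefined μ α (shiftedProduct Ψ τ ν) ∧
      ∀ r ∈ ({generalizedSpectralRadius, jointSpectralRadius} : Set (Set (L2Op μ) → ℝ≥0∞)),
        setNorm (hadamardSet μ α Ψ) ≤
          r (hadamardSet μ α (adjointProduct Ψ τ ν)) ^ (1 / 2 : ℝ) ∧
        r (hadamardSet μ α (adjointProduct Ψ τ ν)) ^ (1 / 2 : ℝ) ≤
          r (hadamardSet μ α (shiftedProduct Ψ τ ν)) ^ (1 / (2 * m) : ℝ) ∧
        r (hadamardSet μ α (shiftedProduct Ψ τ ν)) ^ (1 / (2 * m) : ℝ) ≤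
          r (List.ofFn (adjointProduct Ψ τ ν)).prod ^ (α / 2 : ℝ) := by
  have hm0 : m ≠ 0 := by omega
  have hmR : (0 : ℝ) < m := by positivity
  have hΘ : ∀ j, ∀ A ∈ adjointProduct Ψ τ ν j, IsPositiveKernelOperator μ A := by
    rintro j _ ⟨A, hA, B, hB, rfl⟩
    have hA' := (hΨ (τ j) _ hA).star
    rw [star_star] at hA'
    exact hA'.mul (hΨ _ B hB)
  have hΘb : ∀ j, setNorm (adjointProduct Ψ τ ν j) ≠ ∞ := by
    intro j
    refine ne_top_of_le_ne_top (ENNReal.mul_ne_top (setNorm_ne_top (hb (τ j)))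
      (setNorm_ne_top (hb (ν j)))) ((setNorm_mul_le _ _).trans ?_)
    gcongr
    refine setNorm_le fun A hA => ?_
    have hA' : ‖A‖ₑ = ‖star A‖ₑ :=
      enorm_eq_iff_norm_eq.2 (LinearIsometryEquiv.norm_map ContinuousLinearMap.adjoint A).symm
    rw [hA']
    exact enorm_le_setNorm hA
  refine ⟨fun A hA => h.exists_isHadamardProduct fun j => hΨ j _ (hA j),
    fun A hA => h.exists_isHadamardProduct fun j => hΘ j _ (hA j),
    fun A hA => h.exists_isHadamardProduct fun j => ?_, fun r hr => ⟨?_, ?_, ?_⟩⟩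
  · obtain ⟨B, hB⟩ := Set.mem_prod_list_ofFn.1 (hA j)
    rw [← hB]
    refine .list_prod (by simpa using hm0) fun C hC => ?_
    obtain ⟨i, rfl⟩ := (List.mem_ofFn' _ _).1 hC
    exact hΘ _ _ (B i).2
  · refine (h.setNorm_hadamardSet_le Ψ τ ν).trans (ENNReal.rpow_le_rpow ?_ (by norm_num))
    rcases hr with rfl | rfl
    exacts [le_rfl, generalizedSpectralRadius_le_jointSpectralRadius _]
  · have hdom := h.exists_dominated_cyclicProduct hm0 (adjointProduct Ψ τ ν)
    have key : r (hadamardSet μ α (adjointProduct Ψ τ ν)) ≤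
        r (hadamardSet μ α (shiftedProduct Ψ τ ν)) ^ (1 / m : ℝ) := by
      rcases hr with rfl | rfl
      exacts [generalizedSpectralRadius_le_of_dominated hm0 hdom,
        jointSpectralRadius_le_of_dominated hm0 (h.setNorm_hadamardSet_ne_top hΘb) hdom]
    refine (ENNReal.rpow_le_rpow key (by norm_num)).trans_eq ?_
    rw [← ENNReal.rpow_mul]
    congr 1
    field_simp
  · have hcyc := radius_cyclicProduct_le hr hΘb
    have key : r (hadamardSet μ α (shiftedProduct Ψ τ ν)) ≤
        r (List.ofFn (adjointProduct Ψ τ ν)).prod ^ (m * α) := by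
      rcases hr with rfl | rfl
      exacts [h.generalizedSpectralRadius_le hm0 hcyc, h.jointSpectralRadius_le hm0 hcyc]
    refine (ENNReal.rpow_le_rpow key (by positivity)).trans_eq ?_
    rw [← ENNReal.rpow_mul]
    congr 1
    field_simp

end Comparison

theorem theorem3p13
    {X : Type*} [MeasurableSpace X] (μ : Measure X) [SigmaFinite μ]
    {R : Type*} [Countable R] [MeasurableSpace R] [DiscreteMeasurableSpace R]
    (m : ℕ) (hm : 1 ≤ m) (τ ν : Equiv.Perm (Fin m)) :
    -- part (i): positive kernel operators on `L²(X, μ)`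
    (∀ Ψ : Fin m → Set (L2Op μ),
      (∀ j, Bornology.IsBounded (Ψ j)) →
      (∀ j, ∀ A ∈ Ψ j, IsPositiveKernelOperator μ A) →
      HadamardDefined μ (1 / m) Ψ ∧
      HadamardDefined μ (1 / m) (adjointProduct Ψ τ ν) ∧
      HadamardDefined μ (1 / m) (shiftedProduct Ψ τ ν) ∧
      ∀ r ∈ ({generalizedSpectralRadius, jointSpectralRadius} : Set (Set (L2Op μ) → ℝ≥0∞)),
        setNorm (hadamardSet μ (1 / m) Ψ) ≤
          r (hadamardSet μ (1 / m) (adjointProduct Ψ τ ν)) ^ (1 / 2 : ℝ) ∧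
        r (hadamardSet μ (1 / m) (adjointProduct Ψ τ ν)) ^ (1 / 2 : ℝ) ≤
          r (hadamardSet μ (1 / m) (shiftedProduct Ψ τ ν)) ^ (1 / (2 * m) : ℝ) ∧
        r (hadamardSet μ (1 / m) (shiftedProduct Ψ τ ν)) ^ (1 / (2 * m) : ℝ) ≤
          r (List.ofFn (adjointProduct Ψ τ ν)).prod ^ (1 / (2 * m) : ℝ)) ∧
    -- part (ii): nonnegative matrices on `ℓ²(R)`
    (∀ Ψ : Fin m → Set (L2Op (Measure.count : Measure R)),
      (∀ j, Bornology.IsBounded (Ψ j)) →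
      (∀ j, ∀ A ∈ Ψ j, IsNonnegMatrixOperator A) →
      ∀ α : ℝ, 1 / m ≤ α →
      HadamardDefined Measure.count α Ψ ∧
      HadamardDefined Measure.count α (adjointProduct Ψ τ ν) ∧
      HadamardDefined Measure.count α (shiftedProduct Ψ τ ν) ∧
      ∀ r ∈ ({generalizedSpectralRadius, jointSpectralRadius} :
          Set (Set (L2Op (Measure.count : Measure R)) → ℝ≥0∞)),
        setNorm (hadamardSet Measure.count α Ψ) ≤
          r (hadamardSet Measure.count α (adjointProduct Ψ τ ν)) ^ (1 / 2 : ℝ) ∧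
        r (hadamardSet Measure.count α (adjointProduct Ψ τ ν)) ^ (1 / 2 : ℝ) ≤
          r (hadamardSet Measure.count α (shiftedProduct Ψ τ ν)) ^ (1 / (2 * m) : ℝ) ∧
        r (hadamardSet Measure.count α (shiftedProduct Ψ τ ν)) ^ (1 / (2 * m) : ℝ) ≤
          r (List.ofFn (adjointProduct Ψ τ ν)).prod ^ (α / 2 : ℝ)) := by
  have hm0 : (m : ℝ) ≠ 0 := by positivity
  refine ⟨fun Ψ hb hΨ => ?_, fun Ψ hb hΨ α hα => ?_⟩
  · have key := (HadamardExponent.one_div μ hm).radius_chain hm τ ν Ψ hb hΨ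
    have he : (1 / m / 2 : ℝ) = 1 / (2 * m) := by
      field_simp
    rwa [he] at key
  · refine (HadamardExponent.count R hm hα).radius_chain hm τ ν Ψ hb fun j A hA => ?_
    obtain ⟨a, ha⟩ := hΨ j A hA
    exact ⟨a, (hasNonnegKernel_count_iff A a).2 ha⟩
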